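/- All graphs are finite and loopless; parallel edges are allowed. A graph is cubic if every vertex is incident with exactly three edges, and $3$-connected if it has more than three vertices and remains connected after the deletion of any set of fewer than three vertices. An edge is called lonely if it belongs to exactly one perfect matching of the graph, and $l(G)$ denotes the number of lonely edges of $G$. Let $\mathcal{U}$ be the class of $3$-connected cubic graphs having at least one lonely edge, and for $k\ge 1$ let $\mathcal{U}_k$ be the class of all $G\in\mathcal{U}$ with $l(G)=k$. Let the prism be the graph consisting of two disjoint triangles joined by a perfect matching (three edges), and let the bicorn be the graph obtained from the prism by replacing a vertex $v$ with a triangle, i.e. by deleting $v$, adding three new pairwise adjacent vertices, and joining these by a perfect matching to the three neighbours of $v$. Then: 1. $l(G)\le 6$ for every $G\in\mathcal{U}$; 2. up to isomorphism, $K_4$ and the prism are the only elements of $\mathcal{U}_6$ (and both belong to $\mathcal{U}_6$); 3. up to isomorphism, the bicorn is the only element of $\mathcal{U}_5$ (and it belongs to $\mathcal{U}_5$). -/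

import Mathlib

namespace Graph

universe u v u' v'

variable {α : Type u} {β : Type v} {α' : Type u'} {β' : Type v'}

/-- A (multi)graph is cubic if it has no loops and every vertex is incident with exactly three
edges. Parallel edges are allowed. -/
def IsCubic (G : Graph α β) : Prop :=
  G.Loopless ∧ ∀ x ∈ V(G), (G.incidenceSet x).encard = 3

/-- A graph is connected if it has a vertex and any two vertices are joined by a walk. -/
def IsConnected (G : Graph α β) : Prop :=
  V(G).Nonempty ∧ ∀ x ∈ V(G), ∀ y ∈ V(G), Relation.ReflTransGen G.Adj x y

/-- A graph is (vertex-)`k`-connected if it has more than `k` vertices and it stays connected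
whenever fewer than `k` vertices are deleted. -/
def IsVertexConnected (k : ℕ) (G : Graph α β) : Prop :=
  (k : ℕ∞) < V(G).encard ∧
    ∀ X ⊆ V(G), X.encard < (k : ℕ∞) → (G.deleteVerts X).IsConnected

/-- A perfect matching, as a set of edges: every vertex is incident with exactly one of them. -/
def IsPerfectMatching (G : Graph α β) (M : Set β) : Prop :=
  M ⊆ E(G) ∧ ∀ x ∈ V(G), ∃! e, e ∈ M ∧ G.Inc e x

/-- An edge is lonely if it belongs to exactly one perfect matching. -/
def IsLonely (G : Graph α β) (e : β) : Prop :=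
  e ∈ E(G) ∧ ∃! M : Set β, G.IsPerfectMatching M ∧ e ∈ M

/-- The number `l(G)` of lonely edges of `G`. -/
noncomputable def lonelyCount (G : Graph α β) : ℕ∞ :=
  {e | G.IsLonely e}.encard

/-- The class `𝒰` of finite 3-connected cubic graphs with at least one lonely edge. -/
def MemU (G : Graph α β) : Prop :=
  V(G).Finite ∧ G.IsCubic ∧ G.IsVertexConnected 3 ∧ ∃ e, G.IsLonely e

/-- The class `𝒰ₖ` of the graphs in `𝒰` with exactly `k` lonely edges. -/
def MemUExactly (k : ℕ) (G : Graph α β) : Prop :=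
  G.MemU ∧ G.lonelyCount = (k : ℕ∞)

/-- Isomorphism of (multi)graphs: bijections between the vertex sets and between the edge sets
that preserve and reflect which edge joins which vertices. -/
def IsIsomorphic (G : Graph α β) (H : Graph α' β') : Prop :=
  ∃ (φ : V(G) ≃ V(H)) (ψ : E(G) ≃ E(H)), ∀ (e : E(G)) (x y : V(G)),
    G.IsLink (e : β) (x : α) (y : α) ↔ H.IsLink (ψ e : β') (φ x : α') (φ y : α')

/-- The complete graph on four vertices. -/
def completeFour : Graph (Fin 4) (Sym2 (Fin 4)) :=
  ofSimpleGraph (⊤ : SimpleGraph (Fin 4))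

/-- The prism: two disjoint triangles `012` and `345`, joined by the perfect matching
`03`, `14`, `25`. -/
def prism : Graph (Fin 6) (Sym2 (Fin 6)) :=
  ofSimpleGraph (SimpleGraph.fromEdgeSet
    {s(0, 1), s(1, 2), s(0, 2),
     s(3, 4), s(4, 5), s(3, 5),
     s(0, 3), s(1, 4), s(2, 5)})

/-- The bicorn: the prism with triangles `567` and `a34`, matching edges `45`, `37`, `a6`,
in which the triangle-vertex `a` has been replaced by the triangle `012`
(so `a4`, `a6`, `a3` become `04`, `16`, `23`). -/
def bicorn : Graph (Fin 8) (Sym2 (Fin 8)) :=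
  ofSimpleGraph (SimpleGraph.fromEdgeSet
    {s(0, 1), s(1, 2), s(0, 2),
     s(0, 4), s(1, 6), s(2, 3),
     s(3, 4), s(4, 5), s(3, 7),
     s(5, 6), s(5, 7), s(6, 7)})

end Graph

/-! In a 3-connected cubic graph every vertex has three distinct neighbours, so there are no
parallel edges; such a graph is also 3-edge-connected. The argument therefore lives in cubic
3-edge-connected simple graphs, where a perfect matching is a fixed-point-free involution along
edges.

Lonely edges force triangles. If `uv` is lonely, then `W = V \ {u, v}` has a unique perfect
matching, and four edges leave `W`. Delete a matching edge and apply Tutte's theorem: some `S`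
leaves at least `|S| + 2` odd components, each sending out at least three edges, while at most `3|S|
+ 4 + 2` edge ends are available. Equality holds throughout, so each component has exactly three
leaving edges. Following edges between these components and `S` yields either a bridge of `G[W]`
inside the matching or a second matching (`Cubic3.exists_bridge`, a form of Kotzig's theorem). The
bridge splits `W` into two parts with three leaving edges each. Removing the bridge end from a part
with more than three vertices gives a smaller set of the same kind; a part with exactly three
vertices is a triangle. The same splitting shows that edges leaving a triangle are not lonely beyond
`K₄`.

Contracting a triangle keeps the graph cubic and 3-edge-connected. Each perfect matching of the
contracted graph lifts to one using a single edge out of the triangle. Hence lonely edges stay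
lonely after contraction, a triangle edge being sent to the edge that leaves the opposite corner,
and this map is injective: the number of lonely edges never grows under expansion of a vertex.

So every graph in question arises from `K₄` by expansions. `K₄` (6 lonely edges) expands only to the
prism (6), and the prism, being vertex-transitive, only to the bicorn (5). For each vertex `z` of
the bicorn, the vertices other than `z` and its neighbours have a perfect matching containing a
lonely edge. After expansion of `z`, this matching together with the three edges leaving the
triangle is a new perfect matching through that edge, which stops being lonely. At most 4 lonely
edges remain, and further expansions cannot raise the number. -/

namespace LonelyEdge

open Finset

/-! ### Edge counts between vertex sets; matchings as involutions -/

open scoped Classical in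
/-- The number of ordered pairs `(x, y) ∈ X × Y` of adjacent vertices. -/
noncomputable def cut {V : Type*} (G : SimpleGraph V) (X Y : Finset V) : ℕ :=
  ∑ x ∈ X, ∑ y ∈ Y, if G.Adj x y then 1 else 0

/-- The map `m` is a perfect matching of the subgraph induced on `W`: it sends every vertex of `W`
to its partner and fixes every other vertex. -/
def IsPM {V : Type*} (G : SimpleGraph V) (W : Finset V) (m : V → V) : Prop :=
  (∀ v ∈ W, m v ∈ W ∧ G.Adj v (m v) ∧ m (m v) = v) ∧ ∀ v ∉ W, m v = v

section Basic

open scoped Classical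

variable {V : Type*} {G : SimpleGraph V} {X Y Z W : Finset V} {x y : V} {m : V → V}

theorem cut_comm (X Y : Finset V) : cut G X Y = cut G Y X := by
  unfold cut
  rw [sum_comm]
  simp_rw [G.adj_comm]

theorem cut_union_left [DecidableEq V] (h : Disjoint X Y) (Z : Finset V) :
    cut G (X ∪ Y) Z = cut G X Z + cut G Y Z := by
  unfold cut
  rw [sum_union h]

theorem cut_union_right [DecidableEq V] (h : Disjoint X Y) (Z : Finset V) :
    cut G Z (X ∪ Y) = cut G Z X + cut G Z Y := by
  rw [cut_comm, cut_union_left h, cut_comm X, cut_comm Y]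

theorem cut_mono {X' Y' : Finset V} (hX : X ⊆ X') (hY : Y ⊆ Y') : cut G X Y ≤ cut G X' Y' := by
  unfold cut
  refine (sum_le_sum fun x _ => sum_le_sum_of_subset hY).trans (sum_le_sum_of_subset hX)

theorem cut_eq_zero_iff : cut G X Y = 0 ↔ ∀ x ∈ X, ∀ y ∈ Y, ¬ G.Adj x y := by
  simp [cut]

theorem cut_pos (hx : x ∈ X) (hy : y ∈ Y) (h : G.Adj x y) : 0 < cut G X Y := by
  rw [Nat.pos_iff_ne_zero, Ne, cut_eq_zero_iff]
  exact fun h' => h' x hx y hy h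

theorem cut_eq_sum (X Y : Finset V) : cut G X Y = ∑ x ∈ X, cut G {x} Y := by
  simp [cut]

theorem cut_singleton_self : cut G {x} {x} = 0 := by simp [cut]

theorem cut_singleton (x : V) (Y : Finset V) : cut G {x} Y = #{y ∈ Y | G.Adj x y} := by
  simp [cut]

theorem cut_pair (h : G.Adj x y) : cut G {x} {y} = 1 := by
  unfold cut
  simp only [sum_singleton, h, if_true]

theorem two_le_cut {z : V} (hy : y ∈ Y) (hz : z ∈ Y) (hyz : y ≠ z)
    (hxy : G.Adj x y) (hxz : G.Adj x z) : 2 ≤ cut G {x} Y := by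
  rw [cut_singleton, ← card_pair hyz]
  refine card_le_card ?_
  intro w hw
  rw [mem_insert, mem_singleton] at hw
  rcases hw with rfl | rfl <;> simp [*]

theorem cut_biUnion_left {ι : Type*} {s : Finset ι} {f : ι → Finset V}
    (h : (s : Set ι).PairwiseDisjoint f) (Z : Finset V) :
    cut G (s.biUnion f) Z = ∑ i ∈ s, cut G (f i) Z := by
  unfold cut
  rw [sum_biUnion h]

/-- Ordered pairs are counted, so each inner edge contributes twice. This is the source of all
parity arguments on boundaries. -/
theorem even_cut_self (X : Finset V) : Even (cut G X X) := by
  induction X using Finset.induction_on with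
  | empty => simp [cut]
  | insert a s ha ih =>
    have hd : Disjoint ({a} : Finset V) s := by simpa using ha
    rw [insert_eq, cut_union_left hd, cut_union_right hd, cut_union_right hd, cut_singleton_self,
      cut_comm s {a}]
    obtain ⟨k, hk⟩ := ih
    exact ⟨cut G {a} s + k, by omega⟩

theorem IsPM.apply_apply (h : IsPM G W m) (v : V) : m (m v) = v := by
  by_cases hv : v ∈ W
  · exact (h.1 v hv).2.2
  · rw [h.2 v hv, h.2 v hv]

theorem IsPM.injective (h : IsPM G W m) : Function.Injective m :=
  Function.LeftInverse.injective h.apply_apply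

theorem IsPM.even_card (h : IsPM G W m) : Even #W := by
  have h0 : ∑ _x ∈ W, (1 : ZMod 2) = 0 :=
    sum_involution (fun v _ => m v) (fun _ _ => by decide) (fun v hv _ => (h.1 v hv).2.1.ne')
      (fun v hv => (h.1 v hv).1) (fun v _ => h.apply_apply v)
  rw [sum_const, nsmul_one, ZMod.natCast_eq_zero_iff] at h0
  exact even_iff_two_dvd.2 h0

end Basic

/-! ### Tutte's theorem with surplus two -/

/-- Tutte's theorem, for the subgraph induced on a set of even size. -/
theorem exists_tutte_family {V : Type*} [Fintype V] (Q : SimpleGraph V) (W : Finset V)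
    (hW : Even #W) (h : ¬ ∃ m, IsPM Q W m) :
    ∃ (S : Finset V) (F : Finset (Finset V)), S ⊆ W ∧ #S + 2 ≤ #F ∧
      (∀ C ∈ F, C ⊆ W ∧ Disjoint C S ∧ Odd #C ∧ ∀ x ∈ C, ∀ y ∈ W, Q.Adj x y → y ∈ C ∨ y ∈ S) ∧
      (F : Set (Finset V)).PairwiseDisjoint id := by
  classical
  set H : SimpleGraph W := Q.comap (Subtype.val : W → V) with hH
  have hno : ¬ ∃ M : H.Subgraph, M.IsPerfectMatching := by
    rintro ⟨M, hM⟩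
    have hM' := SimpleGraph.Subgraph.isPerfectMatching_iff.1 hM
    choose p hp hp' using hM'
    refine h ⟨fun v => if hv : v ∈ W then (p ⟨v, hv⟩ : V) else v, fun v hv => ?_, fun v hv => ?_⟩
    · have h1 : p (p ⟨v, hv⟩) = ⟨v, hv⟩ := (hp' _ _ (hp ⟨v, hv⟩).symm).symm
      have h2 := M.adj_sub (hp ⟨v, hv⟩)
      have h3 : ((p ⟨v, hv⟩ : W) : V) ∈ W := (p ⟨v, hv⟩).2
      simp only [hv, dif_pos]
      refine ⟨h3, h2, ?_⟩
      rw [dif_pos h3]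
      exact congrArg Subtype.val h1
    · simp [hv]
  rw [SimpleGraph.tutte] at hno
  push Not at hno
  obtain ⟨u, hu⟩ := hno
  unfold SimpleGraph.IsTutteViolator at hu
  set K := ((⊤ : H.Subgraph).deleteVerts u).coe with hK
  have hpar := K.odd_ncard_oddComponents
  have hcard : Nat.card ((⊤ : H.Subgraph).deleteVerts u).verts + u.ncard = #W := by
    rw [Nat.card_coe_set_eq]
    have : ((⊤ : H.Subgraph).deleteVerts u).verts = uᶜ := by
      ext; simp
    rw [this, add_comm, Set.ncard_add_ncard_compl]
    simp
  -- The number of odd components has the parity of the number of remaining vertices, hence that of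
  -- `u`, since `W` is even. A surplus of one is thus impossible.
  have hge : u.ncard + 2 ≤ K.oddComponents.ncard := by
    by_contra hlt
    have heq : K.oddComponents.ncard = u.ncard + 1 := by omega
    rw [heq] at hpar
    have h3 : Even (Nat.card ((⊤ : H.Subgraph).deleteVerts u).verts + u.ncard) := hcard ▸ hW
    rcases Nat.even_or_odd u.ncard with h4 | h4
    · have := hpar.1 h4.add_one
      rw [Nat.even_add] at h3
      exact (Nat.not_even_iff_odd.2 this) (h3.2 h4)
    · have h5 : ¬ Odd (u.ncard + 1) := by simpa using h4.add_one
      rw [hpar, Nat.not_odd_iff_even, ] at h5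
      rw [Nat.even_add] at h3
      exact (Nat.not_even_iff_odd.2 h4) (h3.1 h5)
  let e : K.ConnectedComponent → Finset V := fun c => (c.supp.toFinset).image
    fun z : ((⊤ : H.Subgraph).deleteVerts u).verts => ((z : W) : V)
  have hmem : ∀ c z, z ∈ e c ↔ ∃ z' ∈ c.supp, ((z' : W) : V) = z := by
    intro c z; simp [e]
  have hinjv : Function.Injective
      (fun z : ((⊤ : H.Subgraph).deleteVerts u).verts => ((z : W) : V)) :=
    Subtype.val_injective.comp Subtype.val_injective
  have hdisj : ∀ c c' z, z ∈ e c → z ∈ e c' → c = c' := by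
    intro c c' z h1 h2
    obtain ⟨a, ha, rfl⟩ := (hmem _ _).1 h1
    obtain ⟨b, hb, hab⟩ := (hmem _ _).1 h2
    obtain rfl := hinjv hab
    exact (SimpleGraph.ConnectedComponent.mem_supp_iff _ _).1 ha ▸
      (SimpleGraph.ConnectedComponent.mem_supp_iff _ _).1 hb ▸ rfl
  have hinj : Function.Injective e := by
    intro c c' hcc
    obtain ⟨z, hz⟩ := c.nonempty_supp
    have h1 : ((z : W) : V) ∈ e c := (hmem _ _).2 ⟨z, hz, rfl⟩
    exact hdisj _ _ _ h1 (hcc ▸ h1)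
  refine ⟨u.toFinset.map (Function.Embedding.subtype _),
    K.oddComponents.toFinset.image e, ?_, ?_, ?_, ?_⟩
  · intro x hx
    obtain ⟨y, _, rfl⟩ := mem_map.1 hx
    exact y.2
  · rw [card_image_of_injective _ hinj, card_map, ← Set.ncard_eq_toFinset_card',
      ← Set.ncard_eq_toFinset_card']
    exact hge
  · intro C hC
    obtain ⟨c, hc, rfl⟩ := mem_image.1 hC
    refine ⟨?_, ?_, ?_, ?_⟩
    · intro x hx
      obtain ⟨z, _, rfl⟩ := (hmem _ _).1 hx
      exact (z : W).2
    · rw [Finset.disjoint_left]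
      intro x hx hx'
      obtain ⟨z, _, rfl⟩ := (hmem _ _).1 hx
      obtain ⟨y, hy, hyz⟩ := mem_map.1 hx'
      have : y = (z : W) := Subtype.ext hyz
      subst this
      exact z.2.2 (by simpa using hy)
    · rw [card_image_of_injective _ hinjv, ← Set.ncard_eq_toFinset_card']
      simpa using hc
    · intro x hx y hy hxy
      obtain ⟨z, hz, rfl⟩ := (hmem _ _).1 hx
      by_cases hyu : (⟨y, hy⟩ : W) ∈ u
      · right
        simp [hyu, hy]
      · left
        have hyv : (⟨y, hy⟩ : W) ∈ ((⊤ : H.Subgraph).deleteVerts u).verts := by simpa using hyu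
        refine (hmem _ _).2 ⟨⟨⟨y, hy⟩, hyv⟩, ?_, rfl⟩
        refine SimpleGraph.ConnectedComponent.mem_supp_of_adj_mem_supp _ hz ?_
        have hzu : (z : W) ∉ u := z.2.2
        simp [hK, hH, hzu, hyu, hxy]
  · intro C hC C' hC' hne
    simp only [coe_image, Set.mem_image] at hC hC'
    obtain ⟨c, -, rfl⟩ := hC
    obtain ⟨c', -, rfl⟩ := hC'
    simp only [Function.onFun, id]
    rw [Finset.disjoint_left]
    intro x hx hx'
    exact hne (congrArg e (hdisj _ _ _ hx hx'))

/-! ### Cubic 3-edge-connected graphs and surgery on matchings -/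

/-- A simple graph is cubic and 3-edge-connected. -/
structure Cubic3 {V : Type*} [Fintype V] (G : SimpleGraph V) : Prop where
  deg : ∀ v, cut G {v} univ = 3
  conn : ∀ X Y : Finset V, X.Nonempty → Y.Nonempty → (∀ v, v ∈ X ↔ v ∉ Y) → 3 ≤ cut G X Y

/-- The map `m` is the only perfect matching of the subgraph induced on `W`. -/
def UniqPM {V : Type*} (G : SimpleGraph V) (W : Finset V) (m : V → V) : Prop :=
  IsPM G W m ∧ ∀ m', IsPM G W m' → m' = m

section Matchings

open scoped Classical

variable {V : Type*} {G : SimpleGraph V} {U W : Finset V} {c t : V} {m k : V → V}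

theorem IsPM.insert_pair (hk : IsPM G U k) (hc : c ∉ U) (ht : t ∉ U) (h : G.Adj c t) :
    ∃ n, IsPM G (insert c (insert t U)) n ∧ n c = t ∧ n t = c ∧ ∀ v ∈ U, n v = k v := by
  have hne := h.ne
  refine ⟨fun v => if v = c then t else if v = t then c else k v, ⟨fun v hv => ?_, fun v hv => ?_⟩,
    by simp, by simp [hne.symm], fun v hv => ?_⟩
  · rcases eq_or_ne v c with rfl | h1
    · simp [hne.symm, h]
    rcases eq_or_ne v t with rfl | h2
    · simp [h1, h.symm]
    have hv' : v ∈ U := by simpa [h1, h2] using hv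
    obtain ⟨h3, h4, h5⟩ := hk.1 v hv'
    have h6 : k v ≠ c := fun h => hc (h ▸ h3)
    have h7 : k v ≠ t := fun h => ht (h ▸ h3)
    simp [h1, h2, h3, h4, h5, h6, h7]
  · simp only [mem_insert, not_or] at hv
    simp [hv.1, hv.2.1, hk.2 v hv.2.2]
  · have h1 : v ≠ c := fun h => hc (h ▸ hv)
    have h2 : v ≠ t := fun h => ht (h ▸ hv)
    simp [h1, h2]

/-- Replaces `m` on a union of disjoint pieces. Only the union has to be invariant under `m`, not
each piece; this is what allows switching along an alternating cycle. -/
theorem IsPM.glue {ι : Type*} {s : Finset ι} {f : ι → Finset V} {n : ι → V → V}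
    (hm : IsPM G W m) (hdisj : (s : Set ι).PairwiseDisjoint f) (hn : ∀ i ∈ s, IsPM G (f i) (n i))
    (hsub : ∀ i ∈ s, f i ⊆ W) (hinv : ∀ v, (∃ i ∈ s, v ∈ f i) → ∃ i ∈ s, m v ∈ f i) :
    ∃ m', IsPM G W m' ∧ ∀ i ∈ s, ∀ v ∈ f i, m' v = n i v := by
  have key : ∀ i ∈ s, ∀ v ∈ f i, (if h : ∃ i ∈ s, v ∈ f i then n h.choose v else m v) = n i v := by
    intro i hi v hv
    have h : ∃ i ∈ s, v ∈ f i := ⟨i, hi, hv⟩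
    rw [dif_pos h]
    by_contra hne
    refine Finset.disjoint_left.1 (hdisj h.choose_spec.1 hi ?_) h.choose_spec.2 hv
    intro he
    exact hne (by rw [he])
  refine ⟨fun v => if h : ∃ i ∈ s, v ∈ f i then n h.choose v else m v,
    ⟨fun v hv => ?_, fun v hv => ?_⟩, key⟩
  · by_cases h : ∃ i ∈ s, v ∈ f i
    · obtain ⟨i, hi, hvi⟩ := h
      obtain ⟨h1, h2, h3⟩ := (hn i hi).1 v hvi
      have e1 := key i hi v hvi
      have e2 := key i hi _ h1
      refine ⟨?_, ?_, ?_⟩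
      · dsimp only; rw [e1]; exact hsub i hi h1
      · dsimp only; rw [e1]; exact h2
      · dsimp only; rw [e1, e2, h3]
    · have h' : ¬ ∃ i ∈ s, m v ∈ f i := fun h' => h (by simpa [hm.apply_apply] using hinv _ h')
      obtain ⟨h1, h2, h3⟩ := hm.1 v hv
      simp only [h, h', dif_neg, not_false_eq_true]
      exact ⟨h1, h2, h3⟩
  · have h : ¬ ∃ i ∈ s, v ∈ f i := fun ⟨i, hi, hvi⟩ => hv (hsub i hi hvi)
    simp only [h, dif_neg, not_false_eq_true]
    exact hm.2 v hv

theorem IsPM.restrict (hm : IsPM G W m) (hU : U ⊆ W) (hinv : ∀ v ∈ U, m v ∈ U) :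
    IsPM G U fun v => if v ∈ U then m v else v := by
  refine ⟨fun v hv => ?_, fun v hv => by simp [hv]⟩
  have := hm.1 v (hU hv)
  simp [hv, hinv v hv, this]

theorem UniqPM.restrict (hm : UniqPM G W m) (hU : U ⊆ W) (hinv : ∀ v ∈ U, m v ∈ U) :
    UniqPM G U fun v => if v ∈ U then m v else v := by
  refine ⟨hm.1.restrict hU hinv, fun k hk => ?_⟩
  obtain ⟨m', hm', h⟩ := hm.1.glue (s := {()}) (f := fun _ => U) (n := fun _ => k) (by simp)
    (by simpa using hk) (by simpa using hU) (by simpa using hinv)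
  rw [hm.2 m' hm'] at h
  funext v
  by_cases hv : v ∈ U
  · simp [hv, h () (by simp) v hv]
  · simp [hv, hk.2 v hv]

end Matchings

/-! ### Edge boundaries and Tutte families -/

section Boundary

open scoped Classical

variable {V : Type*} [Fintype V] {G : SimpleGraph V}

/-- The number of edges leaving `X`. -/
noncomputable def bd (G : SimpleGraph V) (X : Finset V) : ℕ := cut G X Xᶜ

variable {A B C X W : Finset V} {a b : V}

theorem Cubic3.cut_univ (hG : Cubic3 G) (X : Finset V) : cut G X univ = 3 * #X := by
  rw [cut_eq_sum, sum_congr rfl fun x _ => hG.deg x]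
  simp [mul_comm]

theorem Cubic3.cut_self_add_bd (hG : Cubic3 G) (X : Finset V) : cut G X X + bd G X = 3 * #X := by
  rw [bd, ← cut_union_right disjoint_compl_right, union_compl, hG.cut_univ]

theorem Cubic3.three_le_bd (hG : Cubic3 G) (h : X.Nonempty) (h' : Xᶜ.Nonempty) : 3 ≤ bd G X :=
  hG.conn _ _ h h' (by simp)

theorem Cubic3.odd_bd (hG : Cubic3 G) : Odd (bd G X) ↔ Odd #X := by
  have h1 := hG.cut_self_add_bd X
  obtain ⟨k, hk⟩ := even_cut_self (G := G) X
  rw [Nat.odd_iff, Nat.odd_iff]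
  omega

theorem bd_union (h : Disjoint A B) : bd G (A ∪ B) + 2 * cut G A B = bd G A + bd G B := by
  have hA : Aᶜ = B ∪ (A ∪ B)ᶜ := by
    ext v
    have : v ∈ B → v ∉ A := fun hb ha => Finset.disjoint_left.1 h ha hb
    simp only [mem_compl, mem_union]; tauto
  have hB : Bᶜ = A ∪ (A ∪ B)ᶜ := by
    ext v
    have : v ∈ B → v ∉ A := fun hb ha => Finset.disjoint_left.1 h ha hb
    simp only [mem_compl, mem_union]; tauto
  have h1 : Disjoint B (A ∪ B)ᶜ := disjoint_compl_right.mono_left subset_union_right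
  have h2 : Disjoint A (A ∪ B)ᶜ := disjoint_compl_right.mono_left subset_union_left
  unfold bd
  rw [cut_union_left h, hA, hB, cut_union_right h1, cut_union_right h2, cut_comm B A]
  ring

theorem Cubic3.bd_singleton (hG : Cubic3 G) (x : V) : bd G {x} = 3 := by
  have := hG.cut_self_add_bd {x}
  rw [cut_singleton_self] at this
  simpa using this

theorem Cubic3.cut_singleton_add (hG : Cubic3 G) (x : V) (X : Finset V) :
    cut G {x} X + cut G {x} Xᶜ = 3 := by
  rw [← cut_union_right disjoint_compl_right, union_compl, hG.deg]

theorem Cubic3.bd_erase (hG : Cubic3 G) {x : V} (hx : x ∈ X) :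
    bd G (X.erase x) + 2 * cut G {x} Xᶜ = bd G X + 3 := by
  have h : Disjoint ({x} : Finset V) (X.erase x) := by simp
  have h1 := bd_union (G := G) h
  have h2 := hG.cut_singleton_add x X
  rw [← insert_eq, insert_erase hx, hG.bd_singleton] at h1
  have h3 : cut G {x} X = cut G {x} (X.erase x) := by
    conv_lhs => rw [← insert_erase hx, insert_eq, cut_union_right h, cut_singleton_self, zero_add]
  omega

/-- Otherwise at least `|S| + 2` odd pieces each send three edges into `S` or out of `W`, but at
most `3|S| + 4` edges are available there. -/
theorem Cubic3.exists_pm (hG : Cubic3 G) (hW : Even #W) (hb : bd G W ≤ 4) (hc : Wᶜ.Nonempty) :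
    ∃ m, IsPM G W m := by
  by_contra hno
  obtain ⟨S, F, hS, hcard, hF, hdisj⟩ := exists_tutte_family G W hW hno
  have h1 : ∀ C ∈ F, 3 ≤ cut G C S + cut G C Wᶜ := by
    intro C hC
    obtain ⟨hCW, hCS, hodd, hadj⟩ := hF C hC
    refine (hG.three_le_bd (X := C) (card_pos.1 hodd.pos)
      (hc.mono (compl_subset_compl.2 hCW))).trans ?_
    have h2 : Cᶜ ⊆ (S ∪ Wᶜ) ∪ (W \ (S ∪ C)) := by
      intro v; simp only [mem_compl, mem_union, mem_sdiff]; tauto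
    have h3 : Disjoint (S ∪ Wᶜ) (W \ (S ∪ C)) := by
      rw [Finset.disjoint_left]; intro v; simp only [mem_compl, mem_union, mem_sdiff]; tauto
    have h4 : Disjoint S Wᶜ := disjoint_compl_right.mono_left hS
    have h5 : cut G C (W \ (S ∪ C)) = 0 := by
      rw [cut_eq_zero_iff]
      intro x hx y hy hxy
      simp only [mem_sdiff, mem_union, not_or] at hy
      rcases hadj x hx y hy.1 hxy with h | h
      · exact hy.2.2 h
      · exact hy.2.1 h
    calc bd G C ≤ cut G C ((S ∪ Wᶜ) ∪ (W \ (S ∪ C))) := cut_mono subset_rfl h2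
      _ = _ := by rw [cut_union_right h3, h5, cut_union_right h4, add_zero]
  have h2 : 3 * #F ≤ ∑ C ∈ F, (cut G C S + cut G C Wᶜ) := by
    rw [mul_comm, ← smul_eq_mul]
    exact card_nsmul_le_sum _ _ _ h1
  have h3 : ∀ Z, ∑ C ∈ F, cut G C Z = cut G (F.biUnion id) Z := fun Z =>
    (cut_biUnion_left hdisj Z).symm
  have h4 : cut G (F.biUnion id) S ≤ 3 * #S := by
    rw [cut_comm, ← hG.cut_univ]
    exact cut_mono subset_rfl (subset_univ _)
  have h5 : cut G (F.biUnion id) Wᶜ ≤ bd G W :=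
    cut_mono (biUnion_subset.2 fun C hC => (hF C hC).1) subset_rfl
  rw [sum_add_distrib, h3, h3] at h2
  omega

/-- The Tutte family obtained by deleting an edge `ab` of the unique perfect matching of `W`
when only four edges leave `W`. -/
theorem Cubic3.exists_tight_family (hG : Cubic3 G) {m : V → V} (hm : UniqPM G W m)
    (hb : bd G W = 4) (ha : a ∈ W) :
    ∃ (S : Finset V) (F : Finset (Finset V)), S ⊆ W ∧ #S + 2 ≤ #F ∧
      (F : Set (Finset V)).PairwiseDisjoint id ∧
      ∀ C ∈ F, C ⊆ W ∧ Disjoint C S ∧ bd G C = 3 ∧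
        ∀ x ∈ C, ∀ y ∈ W, G.Adj x y → s(x, y) ≠ s(a, m a) → y ∈ C ∨ y ∈ S := by
  have hc : Wᶜ.Nonempty := by
    by_contra h
    rw [not_nonempty_iff_eq_empty] at h
    rw [bd, h] at hb
    simp [cut] at hb
  set Q := G.deleteEdges {s(a, m a)} with hQ
  have hQadj : ∀ x y, Q.Adj x y ↔ G.Adj x y ∧ s(x, y) ≠ s(a, m a) := by
    intro x y; rw [hQ, SimpleGraph.deleteEdges_adj]; simp
  have hno : ¬ ∃ m', IsPM Q W m' := by
    rintro ⟨m', hm'⟩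
    have h1 : IsPM G W m' :=
      ⟨fun v hv => ⟨(hm'.1 v hv).1, ((hQadj _ _).1 (hm'.1 v hv).2.1).1, (hm'.1 v hv).2.2⟩, hm'.2⟩
    have h2 := hm.2 _ h1
    subst h2
    exact ((hQadj _ _).1 (hm'.1 a ha).2.1).2 rfl
  obtain ⟨S, F, hS, hcard, hF, hdisj⟩ := exists_tutte_family Q W hm.1.even_card hno
  -- From `C` to the rest of `W` outside `S` only the deleted edge can run, so the correction is at
  -- most one for each of its ends in `C`.
  have h1 : ∀ C ∈ F, bd G C ≤
      cut G C S + cut G C Wᶜ + ((if a ∈ C then 1 else 0) + (if m a ∈ C then 1 else 0)) := by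
    intro C hC
    obtain ⟨hCW, hCS, hodd, hadj⟩ := hF C hC
    have h2 : Cᶜ ⊆ (S ∪ Wᶜ) ∪ (W \ (S ∪ C)) := by
      intro v; simp only [mem_compl, mem_union, mem_sdiff]; tauto
    have h3 : Disjoint (S ∪ Wᶜ) (W \ (S ∪ C)) := by
      rw [Finset.disjoint_left]; intro v; simp only [mem_compl, mem_union, mem_sdiff]; tauto
    have h4 : Disjoint S Wᶜ := disjoint_compl_right.mono_left hS
    have h5 : cut G C (W \ (S ∪ C)) ≤ (if a ∈ C then 1 else 0) + (if m a ∈ C then 1 else 0) := by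
      have h6 : ∀ x ∈ C, ∀ y ∈ W \ (S ∪ C), G.Adj x y → x = a ∧ y = m a ∨ x = m a ∧ y = a := by
        intro x hx y hy hxy
        simp only [mem_sdiff, mem_union, not_or] at hy
        by_contra hne
        have := hadj x hx y hy.1 ((hQadj _ _).2 ⟨hxy, by simpa using hne⟩)
        tauto
      have h7 : ∀ x ∈ C, ∀ y ∈ W \ (S ∪ C), (if G.Adj x y then 1 else 0 : ℕ) ≤
          (if x = a then if y = m a then 1 else 0 else 0) +
            (if x = m a then if y = a then 1 else 0 else 0) := by
        intro x hx y hy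
        by_cases hxy : G.Adj x y
        · rcases h6 x hx y hy hxy with ⟨h, h'⟩ | ⟨h, h'⟩ <;> simp only [h, h', if_true] <;>
            split_ifs <;> omega
        · simp [hxy]
      refine (sum_le_sum fun x hx => sum_le_sum (h7 x hx)).trans ?_
      simp only [sum_add_distrib]
      refine add_le_add ?_ ?_
      · rw [← Finset.sum_ite_eq' C a (fun _ => (1 : ℕ))]
        refine sum_le_sum fun x _ => ?_
        split_ifs
        · rw [Finset.sum_ite_eq']; split_ifs <;> simp
        · simp
      · rw [← Finset.sum_ite_eq' C (m a) (fun _ => (1 : ℕ))]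
        refine sum_le_sum fun x _ => ?_
        split_ifs
        · rw [Finset.sum_ite_eq']; split_ifs <;> simp
        · simp
    calc bd G C ≤ cut G C ((S ∪ Wᶜ) ∪ (W \ (S ∪ C))) := cut_mono subset_rfl h2
      _ = cut G C S + cut G C Wᶜ + cut G C (W \ (S ∪ C)) := by
        rw [cut_union_right h3, cut_union_right h4]
      _ ≤ _ := Nat.add_le_add_left h5 _
  have h2 : ∀ C ∈ F, 3 ≤ bd G C := fun C hC =>
    hG.three_le_bd (card_pos.1 (hF C hC).2.2.1.pos) (hc.mono (compl_subset_compl.2 (hF C hC).1))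
  have h3 : ∀ Z, ∑ C ∈ F, cut G C Z = cut G (F.biUnion id) Z := fun Z =>
    (cut_biUnion_left hdisj Z).symm
  have h4 : cut G (F.biUnion id) S ≤ 3 * #S := by
    rw [cut_comm, ← hG.cut_univ]
    exact cut_mono subset_rfl (subset_univ _)
  have h5 : cut G (F.biUnion id) Wᶜ ≤ bd G W :=
    cut_mono (biUnion_subset.2 fun C hC => (hF C hC).1) subset_rfl
  have h6 : ∀ z : V, ∑ C ∈ F, (if z ∈ C then 1 else 0) ≤ 1 := by
    intro z
    rw [← card_filter, card_le_one]
    intro C hC C' hC'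
    rw [mem_filter] at hC hC'
    exact hdisj.elim_finset hC.1 hC'.1 z hC.2 hC'.2
  have h7 := sum_le_sum h1
  simp only [sum_add_distrib, h3] at h7
  have h8 := h6 a
  have h9 := h6 (m a)
  -- The total is at most `3|S| + 4 + 1 + 1 = 3(|S| + 2) ≤ 3|F|`, while every term is at least
  -- three. Hence every term equals three.
  have h10 : ∑ C ∈ F, bd G C ≤ ∑ _C ∈ F, 3 := by rw [sum_const, smul_eq_mul]; omega
  refine ⟨S, F, hS, hcard, hdisj, fun C hC => ⟨(hF C hC).1, (hF C hC).2.1, ?_, ?_⟩⟩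
  · have h11 := (sum_eq_sum_iff_of_le h2).1 (le_antisymm (sum_le_sum h2) h10)
    exact (h11 C hC).symm
  · intro x hx y hy hxy hne
    exact (hF C hC).2.2.2 x hx y hy ((hQadj _ _).2 ⟨hxy, hne⟩)

end Boundary

/-! ### A bridge in the unique matching -/

/-- The periodic points of a self-map of a finite set form a nonempty set that the map permutes;
they supply the cycles along which a matching is switched. -/
theorem exists_finset_bijOn {α : Type*} [Finite α] [Nonempty α] (g : α → α) :
    ∃ P : Finset α, P.Nonempty ∧ Set.BijOn g P P := by
  classical
  have := Fintype.ofFinite α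
  refine ⟨(Function.periodicPts g).toFinset, ?_, by
    simpa using Function.bijOn_periodicPts g⟩
  obtain ⟨i, j, hij, h⟩ := Finite.exists_ne_map_eq_of_infinite
    fun n : ℕ => g^[n] (Classical.arbitrary α)
  wlog hlt : i < j generalizing i j
  · exact this j i hij.symm h.symm (by omega)
  refine ⟨g^[i] (Classical.arbitrary α), ?_⟩
  rw [Set.mem_toFinset]
  refine Function.mk_mem_periodicPts (n := j - i) (by omega) ?_
  change g^[j - i] _ = _
  rw [← Function.iterate_add_apply, Nat.sub_add_cancel hlt.le]
  exact h.symm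

section Kotzig

open scoped Classical

variable {V : Type*} [Fintype V] {G : SimpleGraph V} {A W : Finset V} {a : V} {m : V → V}

/-- Since `c` has a neighbour outside `A`, at most `3 + 3 - 2 = 4` edges leave `A` without `c`, and
its size is even, so `Cubic3.exists_pm` applies. -/
theorem Cubic3.exists_pm_erase (hG : Cubic3 G) {c t : V} (hA : bd G A = 3) (hc : c ∈ A) (ht : t ∉ A)
    (h : G.Adj c t) : ∃ k, IsPM G (A.erase c) k := by
  have h1 := hG.bd_erase hc
  have h2 := cut_pos (X := {c}) (by simp) (mem_compl.2 ht) h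
  have h3 : Odd #A := hG.odd_bd.1 (by rw [hA]; decide)
  refine hG.exists_pm ?_ (by omega) ⟨c, by simp⟩
  rw [card_erase_of_mem hc]
  exact Nat.Odd.sub_odd h3 odd_one

/-- Kotzig's theorem for vertex sets with four leaving edges: a unique perfect matching contains a
bridge. -/
theorem Cubic3.exists_bridge (hG : Cubic3 G) (hm : UniqPM G W m) (hb : bd G W = 4)
    (hW : W.Nonempty) :
    ∃ A ⊆ W, ∃ a ∈ A, m a ∈ W \ A ∧ bd G A = 3 ∧
      ∀ x ∈ A, ∀ y ∈ W \ A, G.Adj x y → x = a ∧ y = m a := by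
  obtain ⟨a, ha⟩ := hW
  obtain ⟨S, F, hS, hcard, hdisj, hF⟩ := hG.exists_tight_family hm hb ha
  have hodd : ∀ C ∈ F, Odd #C := fun C hC => hG.odd_bd.1 (by rw [(hF C hC).2.2.1]; decide)
  have hoff : ∀ C ∈ F, a ∉ C → m a ∉ C → ∀ x ∈ C, ∀ y ∈ W \ C, G.Adj x y → y ∈ S := by
    intro C hC h1 h2 x hx y hy hxy
    rw [mem_sdiff] at hy
    refine ((hF C hC).2.2.2 x hx y hy.1 hxy ?_).resolve_left hy.2
    rw [Ne, Sym2.eq_iff]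
    rintro (⟨rfl, -⟩ | ⟨rfl, -⟩)
    · exact h1 hx
    · exact h2 hx
  set F' := F.filter fun C => a ∉ C ∧ m a ∉ C with hF'
  have hone : ∀ z, #(F.filter fun C => z ∈ C) ≤ 1 := by
    intro z
    rw [card_le_one]
    intro C hC C' hC'
    rw [mem_filter] at hC hC'
    exact hdisj.elim_finset hC.1 hC'.1 z hC.2 hC'.2
  -- Each of `a` and `m a` lies in at most one member, so discarding those members costs at most the
  -- surplus of two.
  have hcard' : #S ≤ #F' := by
    have h1 : F ⊆ F' ∪ (F.filter (fun C => a ∈ C) ∪ F.filter fun C => m a ∈ C) := by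
      intro C hC
      simp only [hF', mem_union, mem_filter]; tauto
    have h2 := card_le_card h1
    have h3 := card_union_le F' (F.filter (fun C => a ∈ C) ∪ F.filter fun C => m a ∈ C)
    have h4 := card_union_le (F.filter (fun C => a ∈ C)) (F.filter fun C => m a ∈ C)
    have h5 := hone a
    have h6 := hone (m a)
    omega
  -- An odd set cannot be matched within itself, and the edges leaving `C` inside `W` all end in
  -- `S`.
  have hexit : ∀ C : F', ∃ x ∈ (C : Finset V), m x ∈ S := by
    rintro ⟨C, hC⟩
    rw [hF', mem_filter] at hC
    by_contra! hno
    have h1 : ∀ v ∈ C, m v ∈ C := by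
      intro v hv
      by_contra hv'
      have h2 := hm.1.1 v ((hF C hC.1).1 hv)
      exact hno v hv (hoff C hC.1 hC.2.1 hC.2.2 v hv _ (mem_sdiff.2 ⟨h2.1, hv'⟩) h2.2.1)
    have h2 := (hm.1.restrict (hF C hC.1).1 h1).even_card
    exact Nat.not_even_iff_odd.2 (hodd C hC.1) h2
  choose x hx hxS using hexit
  have hFF : ∀ C : F', (C : Finset V) ∈ F := fun C => (mem_filter.1 C.2).1
  have huniq : ∀ (C C' : F') v, v ∈ (C : Finset V) → v ∈ (C' : Finset V) → C = C' :=
    fun C C' v h1 h2 => Subtype.ext (hdisj.elim_finset (hFF C) (hFF C') v h1 h2)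
  let s : F' → S := fun C => ⟨m (x C), hxS C⟩
  have hsinj : Function.Injective s := by
    intro C C' h
    have h1 : x C = x C' := hm.1.injective (Subtype.ext_iff.1 h)
    exact huniq C C' _ (hx C) (h1 ▸ hx C')
  -- Counting now shows that every vertex of `S` is matched into exactly one member of `F'`.
  have hsbij : Function.Bijective s := by
    refine (Fintype.bijective_iff_injective_and_card s).2 ⟨hsinj, ?_⟩
    refine le_antisymm (Fintype.card_le_of_injective s hsinj) ?_
    simpa using hcard'
  by_contra hcon
  -- every member of the family away from `a` and its partner has a second edge into `S`
  have hsnd : ∀ C : F', ∃ c ∈ (C : Finset V), ∃ t ∈ S, G.Adj c t ∧ ¬ (c = x C ∧ t = m (x C)) := by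
    intro C
    have hC := mem_filter.1 C.2
    by_contra! hno
    refine hcon ⟨C, (hF C hC.1).1, x C, hx C, ?_, (hF C hC.1).2.2.1, ?_⟩
    · exact mem_sdiff.2 ⟨hS (hxS C), fun h => Finset.disjoint_left.1 (hF C hC.1).2.1 h (hxS C)⟩
    · intro v hv y hy hvy
      exact hno v hv y (hoff C hC.1 hC.2.1 hC.2.2 v hv y hy hvy) hvy
  rcases isEmpty_or_nonempty F' with hemp | hne
  · -- all members of the family contain `a` or its partner
    have hemp' : F' = ∅ := by simpa [Finset.eq_empty_iff_forall_notMem] using hemp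
    have hS0 : S = ∅ := by
      rw [← card_eq_zero, ← Nat.le_zero]
      simpa [hemp'] using hcard'
    have hor : ∀ C ∈ F, a ∈ C ∨ m a ∈ C := by
      intro C hC
      by_contra h
      have : C ∈ F' := by rw [hF', mem_filter]; tauto
      simp [hemp'] at this
    have htwo : 1 < #F := by omega
    obtain ⟨C, hC, D, hD, hCD⟩ := one_lt_card.1 htwo
    have hnot : ∀ v, v ∈ C → v ∉ D := fun v h1 h2 => hCD (hdisj.elim_finset hC hD v h1 h2)
    have hmaW := (hm.1.1 a ha).1
    have hadj : ∀ v ∈ C, ∀ y ∈ W \ C, G.Adj v y → s(v, y) = s(a, m a) := by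
      intro v hv y hy hvy
      rw [mem_sdiff] at hy
      by_contra hne
      have := (hF C hC).2.2.2 v hv y hy.1 hvy hne
      simp [hS0, hy.2] at this
    rcases hor C hC with h1 | h1
    · have h2 : m a ∉ C := fun h2 => by
        rcases hor D hD with h3 | h3
        · exact hnot _ h1 h3
        · exact hnot _ h2 h3
      refine hcon ⟨C, (hF C hC).1, a, h1, mem_sdiff.2 ⟨hmaW, h2⟩, (hF C hC).2.2.1, ?_⟩
      intro v hv y hy hvy
      have := hadj v hv y hy hvy
      rw [Sym2.eq_iff] at this
      rcases this with h | ⟨rfl, rfl⟩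
      · exact h
      · exact absurd hv h2
    · have h2 : a ∉ C := fun h2 => by
        rcases hor D hD with h3 | h3
        · exact hnot _ h2 h3
        · exact hnot _ h1 h3
      refine hcon ⟨C, (hF C hC).1, m a, h1, ?_, (hF C hC).2.2.1, ?_⟩
      · rw [hm.1.apply_apply]; exact mem_sdiff.2 ⟨ha, h2⟩
      intro v hv y hy hvy
      have := hadj v hv y hy hvy
      rw [Sym2.eq_iff] at this
      rw [hm.1.apply_apply]
      rcases this with ⟨rfl, rfl⟩ | h
      · exact absurd hv h2
      · exact h
  · -- follow second edges around a cycle of family members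
    choose c hc t htS hct hnot using hsnd
    -- From `C`, take the second edge to `t C` in `S`, then the matching edge from `t C` to the next
    -- member `g C`.
    choose g hg using fun C : F' => hsbij.2 ⟨t C, htS C⟩
    have hg' : ∀ C, m (x (g C)) = t C := fun C => Subtype.ext_iff.1 (hg C)
    have hSC : ∀ (C : F') v, v ∈ S → v ∉ (C : Finset V) :=
      fun C v h1 h2 => Finset.disjoint_left.1 (hF C (hFF C)).2.1 h2 h1
    obtain ⟨P, ⟨C₀, hC₀⟩, hP⟩ := exists_finset_bijOn g
    -- The piece `C` together with `t C` is matched afresh through the second edge; the rest of `C`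
    -- is matched by `Cubic3.exists_pm_erase`.
    have hpiece : ∀ C : F', ∃ n, IsPM G (insert (t C) (C : Finset V)) n ∧ n (c C) = t C := by
      intro C
      have h1 : t C ∉ (C : Finset V) := hSC C _ (htS C)
      obtain ⟨k, hk⟩ := hG.exists_pm_erase (hF C (hFF C)).2.2.1 (hc C) h1 (hct C)
      obtain ⟨n, hn, hn', -⟩ := hk.insert_pair (by simp) (fun h => h1 (mem_of_mem_erase h)) (hct C)
      rw [Finset.insert_comm, insert_erase (hc C)] at hn
      exact ⟨n, hn, hn'⟩
    choose n hn hnc using hpiece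
    -- As `S` is used up by the vertices `x C`, no other vertex of `C` has its partner outside `C`.
    have hxof : ∀ (C : F') v, v ∈ (C : Finset V) → m v ∉ (C : Finset V) → v = x C := by
      intro C v hv hv'
      have hC := mem_filter.1 C.2
      have h2 := hm.1.1 v ((hF C hC.1).1 hv)
      have h3 := hoff C hC.1 hC.2.1 hC.2.2 v hv _ (mem_sdiff.2 ⟨h2.1, hv'⟩) h2.2.1
      obtain ⟨C', hC'⟩ := hsbij.2 ⟨m v, h3⟩
      have h4 : x C' = v := hm.1.injective (Subtype.ext_iff.1 hC')
      rw [huniq C C' v hv (h4 ▸ hx C'), h4]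
    have hd : (P : Set F').PairwiseDisjoint fun C => insert (t C) (C : Finset V) := by
      intro C hC C' hC' hne
      simp only [Function.onFun]
      rw [Finset.disjoint_left]
      intro v hv hv'
      rw [mem_insert] at hv hv'
      rcases hv with rfl | hv <;> rcases hv' with h | hv'
      · refine hne (hP.injOn hC hC' (hsinj ?_))
        rw [hg, hg]; exact Subtype.ext h
      · exact hSC C' _ (htS C) hv'
      · exact hSC C _ (htS C') (h ▸ hv)
      · exact hne (huniq _ _ _ hv hv')
    have hsub : ∀ C ∈ P, insert (t C) (C : Finset V) ⊆ W := by
      intro C _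
      rw [insert_subset_iff]
      exact ⟨hS (htS C), (hF C (hFF C)).1⟩
    -- The matching edge at `t C` leads to `g C`, and the one leaving `C` leads to `t` of the
    -- preimage of `C` under `g`. Both stay in the union because `g` permutes `P`.
    have hinv : ∀ v, (∃ C ∈ P, v ∈ insert (t C) (C : Finset V)) →
        ∃ C ∈ P, m v ∈ insert (t C) (C : Finset V) := by
      rintro v ⟨C, hC, hv⟩
      rw [mem_insert] at hv
      rcases hv with rfl | hv
      · refine ⟨g C, hP.mapsTo hC, mem_insert_of_mem ?_⟩
        rw [← hg', hm.1.apply_apply]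
        exact hx _
      · by_cases hv' : m v ∈ (C : Finset V)
        · exact ⟨C, hC, mem_insert_of_mem hv'⟩
        · obtain ⟨C', hC', rfl⟩ := hP.surjOn hC
          refine ⟨C', hC', mem_insert.2 (Or.inl ?_)⟩
          rw [hxof _ v hv hv', hg']
    obtain ⟨m', hm', hm'n⟩ := hm.1.glue (s := P) (f := fun C => insert (t C) (C : Finset V))
      (n := n) hd (fun C _ => hn C) hsub hinv
    rw [hm.2 m' hm'] at hm'n
    -- By uniqueness the switched matching is `m`, so the second edge of `C₀` is its matching edge,
    -- contrary to its choice.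
    have h1 := hm'n C₀ hC₀ (c C₀) (mem_insert_of_mem (hc C₀))
    rw [hnc] at h1
    have h2 : c C₀ = x (g C₀) := hm.1.injective (by rw [h1, hg'])
    have h3 : C₀ = g C₀ := huniq _ _ _ (hc C₀) (h2 ▸ hx (g C₀))
    rw [← h3] at h2
    exact hnot C₀ ⟨h2, by rw [← h2, h1]⟩

end Kotzig

/-! ### Lonely edges and triangles -/

/-- The edge `uv` lies in exactly one perfect matching. -/
def Lonely {V : Type*} [Fintype V] (G : SimpleGraph V) (u v : V) : Prop :=
  G.Adj u v ∧ ∃! m, IsPM G univ m ∧ m u = v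

section Triangles

open scoped Classical

variable {V : Type*} [Fintype V] {G : SimpleGraph V} {A B W : Finset V} {m : V → V} {u v : V}

theorem bd_compl (X : Finset V) : bd G Xᶜ = bd G X := by
  rw [bd, bd, compl_compl, cut_comm]

/-- The bridge in symmetric form: the two boundaries sum to `4 + 2 · 1`, so the second side also has
three leaving edges. -/
theorem Cubic3.exists_bridge_partition (hG : Cubic3 G) (hm : UniqPM G W m) (hb : bd G W = 4)
    (hW : W.Nonempty) :
    ∃ A B, Disjoint A B ∧ A ∪ B = W ∧ bd G A = 3 ∧ bd G B = 3 ∧ ∃ a ∈ A, ∃ b ∈ B,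
      m a = b ∧ m b = a ∧ ∀ x ∈ A, ∀ y ∈ B, G.Adj x y → x = a ∧ y = b := by
  obtain ⟨A, hA, a, ha, hma, hbA, hadj⟩ := hG.exists_bridge hm hb hW
  have hcut : cut G A (W \ A) = 1 := by
    have h1 : cut G A (W \ A) = cut G {a} {m a} := by
      unfold cut
      rw [sum_eq_single_of_mem a ha, sum_eq_single_of_mem (m a) hma]
      · simp only [sum_singleton]
      · intro y hy hne
        rw [if_neg]
        exact fun h => hne (hadj a ha y hy h).2
      · intro x hx hne
        refine sum_eq_zero fun y hy => ?_
        rw [if_neg]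
        exact fun h => hne (hadj x hx y hy h).1
    rw [h1, cut_pair (hm.1.1 a (hA ha)).2.1]
  have hd : Disjoint A (W \ A) := disjoint_sdiff
  have hbd := bd_union (G := G) hd
  rw [union_sdiff_of_subset hA] at hbd
  exact ⟨A, W \ A, hd, union_sdiff_of_subset hA, hbA, by omega, a, ha, m a, hma, rfl,
    hm.1.apply_apply a, hadj⟩

theorem Cubic3.triangle_of_card_eq_three (hG : Cubic3 G) (hA : #A = 3) (hb : bd G A = 3) :
    ∃ x y z, G.Adj x y ∧ G.Adj y z ∧ G.Adj x z := by
  obtain ⟨x, y, z, hxy, hxz, hyz, rfl⟩ := card_eq_three.1 hA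
  refine ⟨x, y, z, ?_⟩
  have h := hG.cut_self_add_bd {x, y, z}
  have h1 : cut G {x, y, z} {x, y, z} = 6 := by omega
  simp only [cut, sum_insert (show x ∉ ({y, z} : Finset V) by simp [hxy, hxz]), sum_singleton,
    sum_insert (show y ∉ ({z} : Finset V) by simp [hyz]), SimpleGraph.irrefl, if_false,
    G.adj_comm y x, G.adj_comm z x, G.adj_comm z y] at h1
  split_ifs at h1 <;> first | omega | exact ⟨‹_›, ‹_›, ‹_›⟩

/-- Split along the bridge. Both sides are odd and one has at least three vertices: with exactly
three it is a triangle, otherwise removing its bridge end leaves a smaller set to which induction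
applies. -/
theorem Cubic3.exists_triangle_of_uniqPM (hG : Cubic3 G) :
    ∀ (n : ℕ) (W : Finset V) (m : V → V), #W = n → UniqPM G W m → bd G W = 4 → 3 ≤ #W →
      ∃ x y z, G.Adj x y ∧ G.Adj y z ∧ G.Adj x z := by
  intro n
  induction n using Nat.strong_induction_on with
  | _ n ih =>
  intro W m hn hm hb hW
  obtain ⟨A, B, hAB, rfl, hbA, hbB, a, ha, b, hb', hab, hba, hadj⟩ :=
    hG.exists_bridge_partition hm hb (card_pos.1 (by omega))
  have side : ∀ C D c d, Disjoint C D → C ∪ D = A ∪ B → bd G C = 3 → c ∈ C → d ∈ D → m c = d →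
      (∀ x ∈ C, ∀ y ∈ D, G.Adj x y → x = c ∧ y = d) → 2 ≤ #C →
      ∃ x y z, G.Adj x y ∧ G.Adj y z ∧ G.Adj x z := by
    intro C D c d hCD hU hbC hc hd hcd hadj hC
    have hdC : d ∉ C := fun h => Finset.disjoint_left.1 hCD h hd
    have hCW : C ⊆ A ∪ B := hU ▸ subset_union_left
    have h1 := hG.bd_erase hc
    have hcdadj : G.Adj c d := hcd ▸ (hm.1.1 c (hCW hc)).2.1
    have h2 := cut_pos (X := {c}) (by simp) (mem_compl.2 hdC) hcdadj
    have h3 : #(C.erase c) + 1 = #C := card_erase_add_one hc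
    -- The boundary is `6 - 2k`, where `k ≥ 1` is the number of edges from `c` out of `C`; being at
    -- least three, it equals 4.
    have h4 : 3 ≤ bd G (C.erase c) := hG.three_le_bd (card_pos.1 (by omega)) ⟨c, by simp⟩
    have h5 : Odd #C := hG.odd_bd.1 (by rw [hbC]; decide)
    -- Only the bridge crosses between `C` and `D`, so every vertex of `C` other than `c` is matched
    -- inside `C`.
    have h6 : UniqPM G (C.erase c) _ := hm.restrict ((erase_subset _ _).trans hCW) (by
      intro v hv
      rw [mem_erase] at hv ⊢
      have h7 := hm.1.1 v (hCW hv.2)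
      refine ⟨fun h => hdC ?_, ?_⟩
      · rw [← hcd, ← h, hm.1.apply_apply]; exact hv.2
      · by_contra h8
        have h9 : m v ∈ D := by
          have := h7.1
          rw [← hU, mem_union] at this
          exact this.resolve_left h8
        exact hv.1 (hadj v hv.2 _ h9 h7.2.1).1)
    rcases Nat.lt_or_ge 3 #C with h7 | h7
    · refine ih #(C.erase c) ?_ _ _ rfl h6 (by omega) (by omega)
      have := card_le_card hCW
      omega
    · obtain ⟨k, hk⟩ := h5
      exact hG.triangle_of_card_eq_three (by omega) hbC
  have hcard := card_union_of_disjoint hAB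
  rcases Nat.lt_or_ge #A 2 with h | h
  · refine side B A b a hAB.symm (union_comm _ _) hbB hb' ha hba ?_ (by omega)
    intro x hx y hy hxy
    exact (hadj y hy x hx hxy.symm).symm
  · exact side A B a b hAB rfl hbA ha hb' hab hadj h

/-- Matchings through `uv` correspond to matchings of the remaining vertices, and `3 + 3 - 2` edges
leave the pair `u`, `v`. -/
theorem Lonely.exists_uniqPM (hG : Cubic3 G) (h : Lonely G u v) :
    (∃ m, UniqPM G ({u, v} : Finset V)ᶜ m) ∧ bd G ({u, v} : Finset V)ᶜ = 4 := by
  obtain ⟨hadj, m, ⟨hm, hmu⟩, huniq⟩ := h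
  have hmv : m v = u := by rw [← hmu, hm.apply_apply]
  constructor
  · have hr := hm.restrict (U := ({u, v} : Finset V)ᶜ) (subset_univ _) (by
      intro x hx
      simp only [mem_compl, mem_insert, mem_singleton, not_or] at hx ⊢
      constructor
      · rintro rfl; exact hx.2 (by rw [← hmu, hm.apply_apply])
      · rintro rfl; exact hx.1 (by rw [← hmv, hm.apply_apply]))
    refine ⟨_, hr, fun k hk => ?_⟩
    obtain ⟨n, hn, hnu, -, hnk⟩ := hk.insert_pair (c := u) (t := v) (by simp) (by simp) hadj
    have hun : insert u (insert v ({u, v} : Finset V)ᶜ) = univ := by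
      ext x; simp only [mem_insert, mem_compl, mem_singleton, mem_univ, iff_true]; tauto
    rw [hun] at hn
    have := huniq n ⟨hn, hnu⟩
    subst this
    funext x
    by_cases hx : x ∈ ({u, v} : Finset V)ᶜ
    · rw [if_pos hx, hnk x hx]
    · rw [if_neg hx, hk.2 x hx]
  · rw [bd_compl, insert_eq]
    have h1 := bd_union (G := G) (A := {u}) (B := {v}) (by simpa using hadj.ne)
    rw [hG.bd_singleton, hG.bd_singleton, cut_pair hadj] at h1
    omega

theorem Cubic3.exists_triangle (hG : Cubic3 G) (h : Lonely G u v) (hV : 4 < Fintype.card V) :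
    ∃ x y z, G.Adj x y ∧ G.Adj y z ∧ G.Adj x z := by
  obtain ⟨⟨m, hm⟩, hb⟩ := h.exists_uniqPM hG
  refine hG.exists_triangle_of_uniqPM _ _ m rfl hm hb ?_
  rw [card_compl, card_pair h.1.ne]
  omega

/-- In a graph other than `K₄`, an edge leaving a triangle is not lonely. -/
theorem Cubic3.not_lonely_of_triangle (hG : Cubic3 G) (hV : 4 < Fintype.card V) {t t' : V}
    (h1 : G.Adj u t) (h2 : G.Adj u t') (h3 : G.Adj t t') (hvt : v ≠ t) (hvt' : v ≠ t') :
    ¬ Lonely G u v := by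
  intro h
  obtain ⟨⟨m, hm⟩, hb⟩ := h.exists_uniqPM hG
  have hcard : #({u, v} : Finset V)ᶜ = Fintype.card V - 2 := by
    rw [card_compl, card_pair h.1.ne]
  obtain ⟨A, B, hAB, hU, hbA, hbB, a, ha, b, hb', hab, hba, hadj⟩ :=
    hG.exists_bridge_partition hm hb (card_pos.1 (by omega))
  have hmem : ∀ x, x ∈ A ∨ x ∈ B ↔ x ≠ u ∧ x ≠ v := by
    intro x
    rw [← mem_union, hU]
    simp
  have ht := (hmem t).2 ⟨h1.ne', hvt.symm⟩
  have ht' := (hmem t').2 ⟨h2.ne', hvt'.symm⟩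
  have huA : u ∉ A := fun h => ((hmem u).1 (Or.inl h)).1 rfl
  have huB : u ∉ B := fun h => ((hmem u).1 (Or.inr h)).1 rfl
  have hvA : v ∉ A := fun h => ((hmem v).1 (Or.inl h)).2 rfl
  have hvB : v ∉ B := fun h => ((hmem v).1 (Or.inr h)).2 rfl
  -- If both other corners lay on one side, adding `u` would leave at most `3 + 3 - 4 = 2` outgoing
  -- edges.
  have htwo : ∀ C, u ∉ C → v ∉ C → bd G C = 3 → ¬ (t ∈ C ∧ t' ∈ C) := by
    rintro C hu hv hC ⟨h4, h5⟩
    have h6 := bd_union (G := G) (A := {u}) (B := C) (by simpa using hu)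
    rw [hG.bd_singleton] at h6
    have h7 := two_le_cut h4 h5 h3.ne h1 h2
    have h8 := hG.three_le_bd (X := {u} ∪ C) ⟨u, by simp⟩ ⟨v, by simp [hv, h.1.ne']⟩
    omega
  -- A corner `x` with two neighbours outside its side `C` must be all of `C`, since otherwise at
  -- most two edges leave `C` without `x`. If the corners are separated, both sides are singletons
  -- and the graph has only four vertices.
  have hone : ∀ C x y, u ∉ C → x ∈ C → y ∉ C → G.Adj x u → G.Adj x y → u ≠ y → bd G C = 3 →
      #C ≤ 1 := by
    intro C x y hu hx hy h4 h5 h6 hC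
    by_contra! h7
    have h8 := hG.bd_erase hx
    have h9 := two_le_cut (mem_compl.2 hu) (mem_compl.2 hy) h6 h4 h5
    have h10 : #(C.erase x) + 1 = #C := card_erase_add_one hx
    have h11 : 3 ≤ bd G (C.erase x) := hG.three_le_bd (card_pos.1 (by omega)) ⟨x, by simp⟩
    omega
  have hcU := card_union_of_disjoint hAB
  rw [hU, hcard] at hcU
  have key : ∀ x y, x ∈ A → y ∈ B → G.Adj u x → G.Adj u y → G.Adj x y → False := by
    intro x y hx hy h4 h5 h6
    have h7 := hone A x y huA hx (fun h => Finset.disjoint_left.1 hAB h hy) h4.symm h6 h5.ne hbA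
    have h8 := hone B y x huB hy (fun h => Finset.disjoint_left.1 hAB hx h) h5.symm h6.symm
      h4.ne hbB
    omega
  rcases ht with ht | ht <;> rcases ht' with ht' | ht'
  · exact htwo A huA hvA hbA ⟨ht, ht'⟩
  · exact key t t' ht ht' h1 h2 h3
  · exact key t' t ht' ht h2 h1 h3.symm
  · exact htwo B huB hvB hbB ⟨ht, ht'⟩

/-- Every edge lies in a perfect matching. -/
theorem Cubic3.exists_pm_of_adj (hG : Cubic3 G) (h : G.Adj u v) :
    ∃ m, IsPM G univ m ∧ m u = v := by
  have hb : bd G ({u, v} : Finset V) = 4 := by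
    rw [insert_eq]
    have h1 := bd_union (G := G) (A := {u}) (B := {v}) (by simpa using h.ne)
    rw [hG.bd_singleton, hG.bd_singleton, cut_pair h] at h1
    omega
  have hpar : ∀ X : Finset V, ¬ Odd (bd G X) → Even #X := by
    intro X hX
    rw [hG.odd_bd] at hX
    exact Nat.not_odd_iff_even.1 hX
  obtain ⟨k, hk⟩ := hG.exists_pm (W := ({u, v} : Finset V)ᶜ)
    (hpar _ (by rw [bd_compl, hb]; decide)) (by rw [bd_compl, hb]) ⟨u, by simp⟩
  obtain ⟨n, hn, hnu, -, -⟩ := hk.insert_pair (c := u) (t := v) (by simp) (by simp) h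
  have hun : insert u (insert v ({u, v} : Finset V)ᶜ) = univ := by
    ext x; simp only [mem_insert, mem_compl, mem_singleton, mem_univ, iff_true]; tauto
  rw [hun] at hn
  exact ⟨n, hn, hnu⟩

end Triangles

/-! ### Expanding a vertex into a triangle, and contracting back -/

/-- The graph obtained from `K` by adding a triangle and joining its vertices `i` to `p i`. -/
def big {X : Type*} (K : SimpleGraph X) (p : Fin 3 → X) : SimpleGraph (X ⊕ Fin 3) where
  Adj
    | .inl x, .inl y => K.Adj x y
    | .inl x, .inr i => p i = x
    | .inr i, .inl x => p i = x
    | .inr i, .inr j => i ≠ j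
  symm := ⟨by
    rintro (x | i) (y | j) h
    · exact K.adj_symm h
    · exact h
    · exact h
    · exact Ne.symm h⟩
  loopless := ⟨by
    rintro (x | i) h
    · exact K.irrefl h
    · exact h rfl⟩

/-- The graph obtained from `K` by adding a vertex joined to each `p i`. -/
def small {X : Type*} (K : SimpleGraph X) (p : Fin 3 → X) : SimpleGraph (Option X) where
  Adj
    | some x, some y => K.Adj x y
    | some x, none => ∃ i, p i = x
    | none, some x => ∃ i, p i = x
    | none, none => False
  symm := ⟨by
    rintro (_ | x) (_ | y) h
    · exact h
    · exact h
    · exact h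
    · exact K.adj_symm h⟩
  loopless := ⟨by
    rintro (_ | x) h
    · exact h
    · exact K.irrefl h⟩

section Adj

variable {X : Type*} {K : SimpleGraph X} {p : Fin 3 → X} {x y : X} {i j : Fin 3}

@[simp] theorem big_inl_inl : (big K p).Adj (.inl x) (.inl y) ↔ K.Adj x y := Iff.rfl
@[simp] theorem big_inl_inr : (big K p).Adj (.inl x) (.inr i) ↔ p i = x := Iff.rfl
@[simp] theorem big_inr_inl : (big K p).Adj (.inr i) (.inl x) ↔ p i = x := Iff.rfl
@[simp] theorem big_inr_inr : (big K p).Adj (.inr i) (.inr j) ↔ i ≠ j := Iff.rfl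
@[simp] theorem small_some_some : (small K p).Adj (some x) (some y) ↔ K.Adj x y := Iff.rfl
@[simp] theorem small_some_none : (small K p).Adj (some x) none ↔ ∃ i, p i = x := Iff.rfl
@[simp] theorem small_none_some : (small K p).Adj none (some x) ↔ ∃ i, p i = x := Iff.rfl
@[simp] theorem small_none_none : ¬ (small K p).Adj none none := id

end Adj

section Cuts

open scoped Classical

theorem cut_eq_sum_univ {V : Type*} [Fintype V] {G : SimpleGraph V} (Y Z : Finset V) :
    cut G Y Z = ∑ y, ∑ z, if y ∈ Y ∧ z ∈ Z ∧ G.Adj y z then 1 else 0 := by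
  unfold cut
  rw [← sum_subset (subset_univ Y)]
  · refine sum_congr rfl fun y hy => ?_
    rw [← sum_subset (subset_univ Z)]
    · exact sum_congr rfl fun z hz => by simp [hy, hz]
    · intro z _ hz; simp [hz]
  · intro y _ hy; simp [hy]

theorem sum_ite_eq_ite_exists {X : Type*} {p : Fin 3 → X} (hp : Function.Injective p) (x : X) :
    ∑ i, (if p i = x then 1 else 0) = if ∃ i, p i = x then 1 else 0 := by
  by_cases h : ∃ i, p i = x
  · obtain ⟨i, rfl⟩ := h
    simp [hp.eq_iff]
  · have h' : ∀ i, p i ≠ x := fun i hi => h ⟨i, hi⟩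
    simp [h']

variable {X : Type*} [Fintype X] {K : SimpleGraph X} {p : Fin 3 → X}

/-- The vertices of `big K p` over a set of vertices of `small K p`. -/
noncomputable def expand (Y : Finset (Option X)) : Finset (X ⊕ Fin 3) :=
  univ.filter fun z => Sum.elim some (fun _ => none) z ∈ Y

@[simp] theorem inl_mem_expand {Y : Finset (Option X)} {x : X} :
    Sum.inl x ∈ expand Y ↔ some x ∈ Y := by simp [expand]

@[simp] theorem inr_mem_expand {Y : Finset (Option X)} {i : Fin 3} :
    Sum.inr i ∈ expand Y ↔ none ∈ Y := by simp [expand]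

/-- Disjointness keeps the triangle in at most one of the two sets, so its inner edges are never
counted; injectivity of `p` makes its three outgoing edges match the three edges at `none`. -/
theorem cut_expand (hp : Function.Injective p) {Y Z : Finset (Option X)} (h : Disjoint Y Z) :
    cut (big K p) (expand Y) (expand Z) = cut (small K p) Y Z := by
  have hYZ : ¬ (none ∈ Y ∧ none ∈ Z) := fun h' => Finset.disjoint_left.1 h h'.1 h'.2
  have hx : ∀ x, (∑ i, if some x ∈ Y ∧ none ∈ Z ∧ p i = x then 1 else 0) =
      if some x ∈ Y ∧ none ∈ Z ∧ ∃ i, p i = x then 1 else 0 := by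
    intro x
    by_cases h1 : some x ∈ Y ∧ none ∈ Z
    · simpa [h1.1, h1.2] using sum_ite_eq_ite_exists hp x
    · rw [if_neg (by tauto)]
      exact sum_eq_zero fun i _ => if_neg (by tauto)
  have hy : ∀ x, (∑ i, if none ∈ Y ∧ some x ∈ Z ∧ p i = x then 1 else 0) =
      if none ∈ Y ∧ some x ∈ Z ∧ ∃ i, p i = x then 1 else 0 := by
    intro x
    by_cases h1 : none ∈ Y ∧ some x ∈ Z
    · simpa [h1.1, h1.2] using sum_ite_eq_ite_exists hp x
    · rw [if_neg (by tauto)]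
      exact sum_eq_zero fun i _ => if_neg (by tauto)
  rw [cut_eq_sum_univ, cut_eq_sum_univ]
  simp only [Fintype.sum_sum_type, Fintype.sum_option, inl_mem_expand, inr_mem_expand,
    big_inl_inl, big_inl_inr, big_inr_inl, big_inr_inr, small_some_some, small_some_none,
    small_none_some, small_none_none, sum_add_distrib, ← and_assoc, hYZ, false_and, if_false,
    and_false, sum_const_zero, add_zero, zero_add]
  rw [sum_comm (s := (univ : Finset (Fin 3)))]
  simp only [and_assoc, hx, hy]
  ring

theorem Cubic3.small (hp : Function.Injective p) (hG : Cubic3 (big K p)) :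
    Cubic3 (LonelyEdge.small K p) := by
  constructor
  · have hself : ∀ v, cut (LonelyEdge.small K p) {v} univ =
        cut (LonelyEdge.small K p) {v} {v}ᶜ := by
      intro v
      rw [← union_compl {v}, cut_union_right disjoint_compl_right, cut_singleton_self, zero_add]
    rintro (_ | x)
    · rw [cut_singleton]
      have : univ.filter (fun y => (LonelyEdge.small K p).Adj none y) =
          univ.image fun i => some (p i) := by
        ext (_ | y) <;> simp
      rw [this, card_image_of_injective _
        (show Function.Injective fun i => some (p i) from (Option.some_injective X).comp hp)]
      simp
    · rw [hself, ← cut_expand hp disjoint_compl_right]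
      refine Eq.trans ?_ (hG.bd_singleton (.inl x))
      unfold bd
      congr 1
      · ext (y | i) <;> simp
      · ext (y | i) <;> simp
  · intro Y Z hY hZ hYZ
    have hd : Disjoint Y Z := by
      rw [Finset.disjoint_left]; exact fun v h => (hYZ v).1 h
    have hne : ∀ Y : Finset (Option X), Y.Nonempty → (expand Y).Nonempty := by
      rintro Y ⟨_ | x, h⟩
      · exact ⟨.inr 0, by simpa using h⟩
      · exact ⟨.inl x, by simpa using h⟩
    rw [← cut_expand hp hd]
    refine hG.conn _ _ (hne Y hY) (hne Z hZ) ?_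
    rintro (x | i)
    · simpa using hYZ (some x)
    · simpa using hYZ none

end Cuts

/-! ### Lifting matchings and transferring lonely edges -/

section Lift

variable {X : Type*} {K : SimpleGraph X} {p : Fin 3 → X}

/-- The map on `X ⊕ Fin 3` obtained from a matching of `small K p` that uses the edge from the
additional vertex to `p i`. -/
def lift (p : Fin 3 → X) (f : Option X → Option X) (i : Fin 3) : X ⊕ Fin 3 → X ⊕ Fin 3 :=
  Sum.elim (fun x => (f (some x)).elim (.inr i) .inl)
    fun j => if j = i then .inl (p i) else .inr (-(i + j))

variable {f g : Option X → Option X} {i j k : Fin 3} {x y : X}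

theorem lift_injective
    (hi : f none = some (p i)) (hj : g none = some (p j)) (h : lift p f i = lift p g j) :
    f = g := by
  have hij : i = j := by
    have h1 := congrFun h (.inr i)
    by_contra hne
    simp [lift, hne] at h1
  subst hij
  funext z
  rcases z with _ | x
  · rw [hi, hj]
  · have h1 := congrFun h (.inl x)
    rcases hx : f (some x) with _ | y <;> rcases hx' : g (some x) with _ | y' <;>
      simp [lift, hx, hx'] at h1 ⊢
    exact h1

variable [Fintype X]

theorem IsPM.exists_apply_none (hf : IsPM (small K p) univ f) : ∃ i, f none = some (p i) := by
  have h := (hf.1 none (mem_univ _)).2.1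
  rcases hf' : f none with _ | x
  · rw [hf'] at h
    exact absurd h small_none_none
  · rw [hf', small_none_some] at h
    obtain ⟨i, rfl⟩ := h
    exact ⟨i, rfl⟩

theorem IsPM.lift (hf : IsPM (small K p) univ f) (hi : f none = some (p i)) :
    IsPM (big K p) univ (lift p f i) := by
  have hi' : f (some (p i)) = none := by rw [← hi, hf.apply_apply]
  refine ⟨?_, fun v hv => absurd (mem_univ v) hv⟩
  rintro (x | j) -
  · refine ⟨mem_univ _, ?_⟩
    rcases hx : f (some x) with _ | y
    · have h1 : some x = some (p i) := by rw [← hi, ← hx, hf.apply_apply]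
      have h2 : x = p i := Option.some_injective _ h1
      simp [LonelyEdge.lift, h2, hi']
    · have h1 : f (some y) = some x := by rw [← hx, hf.apply_apply]
      have h2 := (hf.1 (some x) (mem_univ _)).2.1
      rw [hx] at h2
      simpa [LonelyEdge.lift, hx, h1] using h2
  · refine ⟨mem_univ _, ?_⟩
    by_cases hj : j = i
    · subst hj
      simp [LonelyEdge.lift, hi']
    · have h1 : ∀ i j : Fin 3, j ≠ i → -(i + j) ≠ i ∧ j ≠ -(i + j) ∧ -(i + -(i + j)) = j := by
        decide
      obtain ⟨h2, h3, h4⟩ := h1 i j hj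
      simp only [LonelyEdge.lift, Sum.elim_inr, if_neg hj, if_neg h2, h4, big_inr_inr, ne_eq, h3,
        not_false_eq_true, and_self]

theorem Lonely.symm {V : Type*} [Fintype V] {G : SimpleGraph V} {u v : V} (h : Lonely G u v) :
    Lonely G v u := by
  obtain ⟨h1, m, ⟨h2, h3⟩, h4⟩ := h
  refine ⟨h1.symm, m, ⟨h2, by rw [← h3, h2.apply_apply]⟩, ?_⟩
  rintro m' ⟨h5, h6⟩
  exact h4 m' ⟨h5, by rw [← h6, h5.apply_apply]⟩

/-- Existence holds because every edge of `small K p` lies in a perfect matching. Uniqueness is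
inherited: lifting is injective, and by `hl` every lift contains the lonely edge of `big K p`. -/
theorem Lonely.small_of_lift {v w : X ⊕ Fin 3} {z z' : Option X} (hG : Cubic3 (big K p))
    (hp : Function.Injective p) (h : Lonely (big K p) v w) (hz : (small K p).Adj z z')
    (hl : ∀ f i, IsPM (small K p) univ f → f none = some (p i) → f z = z' → lift p f i v = w) :
    Lonely (small K p) z z' := by
  obtain ⟨f, hf, hfz⟩ := (hG.small hp).exists_pm_of_adj hz
  refine ⟨hz, f, ⟨hf, hfz⟩, ?_⟩
  rintro g ⟨hg, hgz⟩
  obtain ⟨i, hi⟩ := hf.exists_apply_none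
  obtain ⟨j, hj⟩ := hg.exists_apply_none
  exact lift_injective hj hi (h.2.unique ⟨hg.lift hj, hl g j hg hj hgz⟩
    ⟨hf.lift hi, hl f i hf hi hfz⟩)

theorem Lonely.small_inl_inl (hG : Cubic3 (big K p)) (hp : Function.Injective p)
    (h : Lonely (big K p) (.inl x) (.inl y)) : Lonely (small K p) (some x) (some y) := by
  refine h.small_of_lift hG hp h.1 fun f i _ _ hfz => ?_
  simp [lift, hfz]

/-- In `Fin 3` the index `-(j + k)` is the one different from `j` and `k`, as the three indices sum
to zero. A lifted matching contains the triangle edge `jk` when the opposite corner is matched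
outwards. -/
theorem Lonely.small_inr_inr (hG : Cubic3 (big K p)) (hp : Function.Injective p)
    (h : Lonely (big K p) (.inr j) (.inr k)) :
    Lonely (small K p) none (some (p (-(j + k)))) := by
  have hjk : j ≠ k := h.1
  refine h.small_of_lift hG hp (by simp) fun f i _ hi hfz => ?_
  have hi' : i = -(j + k) := hp (Option.some_injective _ (hi.symm.trans hfz))
  subst hi'
  have : ∀ j k : Fin 3, j ≠ k → j ≠ -(j + k) ∧ -(-(j + k) + j) = k := by decide
  obtain ⟨h1, h2⟩ := this j k hjk
  simp only [lift, Sum.elim_inr, if_neg h1, h2]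

theorem not_lonely_inr_inl (hG : Cubic3 (big K p)) (hp : Function.Injective p) :
    ¬ Lonely (big K p) (.inr i) (.inl x) := by
  intro h
  have hcard : 4 < Fintype.card (X ⊕ Fin 3) := by
    have := Fintype.card_le_of_injective p hp
    rw [Fintype.card_sum]
    simp only [Fintype.card_fin] at *
    omega
  refine hG.not_lonely_of_triangle hcard (t := .inr (i + 1)) (t' := .inr (i + 2)) ?_ ?_ ?_
    (by simp) (by simp) h
  all_goals (rw [big_inr_inr]; clear h; revert i; decide)

open scoped Classical in
/-- The number of ordered pairs of vertices joined by a lonely edge. -/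
noncomputable def darts {V : Type*} [Fintype V] (G : SimpleGraph V) : ℕ :=
  #(univ.filter fun q : V × V => Lonely G q.1 q.2)

/-- Sends the lonely darts of `big K p` to lonely darts of `small K p`. -/
def dartMap (p : Fin 3 → X) : (X ⊕ Fin 3) × (X ⊕ Fin 3) → Option X × Option X
  | (.inl x, .inl y) => (some x, some y)
  | (.inr j, .inr k) =>
    if k = j + 1 then (none, some (p (-(j + k)))) else (some (p (-(j + k))), none)
  | _ => (none, none)

theorem dartMap_lonely (hG : Cubic3 (big K p)) (hp : Function.Injective p)
    {q : (X ⊕ Fin 3) × (X ⊕ Fin 3)} (h : Lonely (big K p) q.1 q.2) :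
    Lonely (small K p) (dartMap p q).1 (dartMap p q).2 := by
  obtain ⟨x | j, y | k⟩ := q
  · exact h.small_inl_inl hG hp
  · exact absurd h.symm (not_lonely_inr_inl hG hp)
  · exact absurd h (not_lonely_inr_inl hG hp)
  · have h1 := Lonely.small_inr_inr hG hp h
    unfold dartMap
    dsimp only
    split_ifs
    · exact h1
    · exact h1.symm

/-- Darts between the triangle and `X`, all sent to `(none, none)`, are never lonely. A triangle
dart is recovered from the opposite index, and its direction from the position of `none`. -/
theorem dartMap_injOn (hG : Cubic3 (big K p)) (hp : Function.Injective p) :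
    Set.InjOn (dartMap p) {q | Lonely (big K p) q.1 q.2} := by
  have hd1 : ∀ j k j' k' : Fin 3, k = j + 1 → k' = j' + 1 → -(j + k) = -(j' + k') →
    j = j' ∧ k = k' := by decide
  have hd2 : ∀ j k j' k' : Fin 3, j ≠ k → j' ≠ k' → k ≠ j + 1 → k' ≠ j' + 1 →
    -(j + k) = -(j' + k') → j = j' ∧ k = k' := by decide
  rintro ⟨x | j, y | k⟩ hq ⟨x' | j', y' | k'⟩ hq' h
  all_goals first
    | exact absurd hq (not_lonely_inr_inl hG hp)
    | exact absurd hq.symm (not_lonely_inr_inl hG hp)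
    | exact absurd hq' (not_lonely_inr_inl hG hp)
    | exact absurd hq'.symm (not_lonely_inr_inl hG hp)
    | skip
  · simpa [dartMap] using h
  · simp only [dartMap] at h
    split_ifs at h <;> simp at h
  · simp only [dartMap] at h
    split_ifs at h <;> simp at h
  · have h1 : j ≠ k := hq.1
    have h2 : j' ≠ k' := hq'.1
    simp only [dartMap] at h
    split_ifs at h with h3 h4 h4
    · simp only [Prod.mk.injEq, true_and, Option.some.injEq, hp.eq_iff] at h
      obtain ⟨rfl, rfl⟩ := hd1 _ _ _ _ h3 h4 h
      rfl
    · simp at h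
    · simp at h
    · simp only [Prod.mk.injEq, and_true, Option.some.injEq, hp.eq_iff] at h
      obtain ⟨rfl, rfl⟩ := hd2 _ _ _ _ h1 h2 h3 h4 h
      rfl

theorem darts_big_le (hG : Cubic3 (big K p)) (hp : Function.Injective p) :
    darts (big K p) ≤ darts (small K p) := by
  classical
  unfold darts
  refine card_le_card_of_injOn (dartMap p) (fun q hq => ?_) ?_
  · simpa using dartMap_lonely hG hp (by simpa using hq)
  · simpa using dartMap_injOn hG hp

theorem exists_lonely_small (hG : Cubic3 (big K p)) (hp : Function.Injective p)
    (h : ∃ u v, Lonely (big K p) u v) : ∃ u v, Lonely (small K p) u v := by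
  obtain ⟨u, v, h⟩ := h
  exact ⟨_, _, dartMap_lonely hG hp (q := (u, v)) h⟩

open scoped Classical in
-- Two matchings contain the edge `xy`: `n` together with all three edges leaving the triangle, and
-- the lift of a matching of `small K p` through `xy`.
theorem not_lonely_inl_inl (hG : Cubic3 (big K p)) (hp : Function.Injective p) {n : X → X}
    (hn : IsPM K (univ.filter fun z => ∀ i, p i ≠ z) n) (hx : ∀ i, p i ≠ x) (hxy : n x = y) :
    ¬ Lonely (big K p) (.inl x) (.inl y) := by
  intro h
  let F : X ⊕ Fin 3 → X ⊕ Fin 3 :=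
    Sum.elim (fun z => if h : ∃ i, p i = z then .inr h.choose else .inl (n z)) fun i => .inl (p i)
  have hFp : ∀ i, F (.inl (p i)) = .inr i := by
    intro i
    have h1 : ∃ j, p j = p i := ⟨i, rfl⟩
    simp only [F, Sum.elim_inl, dif_pos h1, Sum.inr.injEq]
    exact hp h1.choose_spec
  have hFn : ∀ z, (∀ i, p i ≠ z) → F (.inl z) = .inl (n z) := by
    intro z hz
    have h1 : ¬ ∃ j, p j = z := fun ⟨i, hi⟩ => hz i hi
    simp only [F, Sum.elim_inl, dif_neg h1]
  have hF : IsPM (big K p) univ F := by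
    refine ⟨?_, fun v hv => absurd (mem_univ v) hv⟩
    rintro (z | i) -
    · refine ⟨mem_univ _, ?_⟩
      by_cases hz : ∃ i, p i = z
      · obtain ⟨i, rfl⟩ := hz
        rw [hFp]
        simp [F]
      · have hz' : ∀ i, p i ≠ z := fun i hi => hz ⟨i, hi⟩
        obtain ⟨h1, h2, h3⟩ := hn.1 z (by simpa using hz')
        rw [hFn z hz', hFn _ (by simpa using h1), h3]
        exact ⟨h2, rfl⟩
    · exact ⟨mem_univ _, rfl, hFp i⟩
  obtain ⟨f, hf, hfx⟩ := (hG.small hp).exists_pm_of_adj (u := some x) (v := some y) h.1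
  obtain ⟨i, hi⟩ := hf.exists_apply_none
  have h1 := h.2.unique ⟨hF, by rw [hFn x hx, hxy]⟩ ⟨hf.lift hi, by simp [lift, hfx]⟩
  -- At a corner other than `i` the lift stays inside the triangle while `F` leaves it.
  have h2 := congrFun h1 (.inr (i + 1))
  simp [F, lift] at h2

open scoped Classical in
-- The injection `dartMap` misses both darts of `xy`: they could only come from `xy` itself, which
-- is no longer lonely in `big K p`.
theorem darts_big_add_two_le (hG : Cubic3 (big K p)) (hp : Function.Injective p) {n : X → X}
    (hn : IsPM K (univ.filter fun z => ∀ i, p i ≠ z) n) (hx : ∀ i, p i ≠ x) (hxy : n x = y)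
    (hl : Lonely (small K p) (some x) (some y)) :
    darts (big K p) + 2 ≤ darts (small K p) := by
  have h1 := not_lonely_inl_inl hG hp hn hx hxy
  have h2 : ({(some x, some y), (some y, some x)} : Finset (Option X × Option X)) ⊆
      univ.filter fun q => Lonely (small K p) q.1 q.2 := by
    intro q hq
    simp only [mem_insert, mem_singleton] at hq
    rcases hq with rfl | rfl
    · simpa using hl
    · simpa using hl.symm
  have hne : x ≠ y := fun h => (small K p).ne_of_adj hl.1 (by rw [h])
  have h3 : #({(some x, some y), (some y, some x)} : Finset (Option X × Option X)) = 2 :=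
    card_pair (by simp [hne])
  unfold darts
  have h4 := card_sdiff_add_card_eq_card h2
  rw [h3] at h4
  rw [← h4]
  refine Nat.add_le_add_right (card_le_card_of_injOn (dartMap p) (fun q hq => ?_) ?_) 2
  · have hq' : Lonely (big K p) q.1 q.2 := by simpa using hq
    rw [coe_sdiff, Set.mem_sdiff]
    refine ⟨by simpa using dartMap_lonely hG hp hq', ?_⟩
    obtain ⟨z | j, w | k⟩ := q
    · simp only [dartMap, coe_insert, coe_singleton, Set.mem_insert_iff, Set.mem_singleton_iff,
        Prod.mk.injEq, Option.some.injEq]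
      rintro (⟨rfl, rfl⟩ | ⟨rfl, rfl⟩)
      · exact h1 hq'
      · exact h1 hq'.symm
    · simp [dartMap]
    · simp [dartMap]
    · simp only [dartMap]
      split_ifs <;> simp
  · simpa using dartMap_injOn hG hp

end Lift

/-! ### Invariance under isomorphism -/

section Iso

open scoped Classical in
theorem cut_map {V V' : Type*} {G : SimpleGraph V} {G' : SimpleGraph V'} (e : G ≃g G')
    (X Y : Finset V) :
    cut G' (X.map e.toEquiv.toEmbedding) (Y.map e.toEquiv.toEmbedding) = cut G X Y := by
  unfold cut
  simp only [sum_map]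
  refine sum_congr rfl fun x _ => sum_congr rfl fun y _ => ?_
  exact if_congr e.map_adj_iff rfl rfl

variable {V V' : Type*} [Fintype V] [Fintype V'] {G : SimpleGraph V} {G' : SimpleGraph V'}

theorem Cubic3.of_iso (e : G ≃g G') (hG : Cubic3 G') : Cubic3 G := by
  constructor
  · intro v
    rw [← cut_map e, map_univ_equiv, map_singleton]
    exact hG.deg _
  · intro X Y hX hY hXY
    rw [← cut_map e]
    refine hG.conn _ _ (hX.map) (hY.map) ?_
    intro v
    obtain ⟨v, rfl⟩ := e.toEquiv.surjective v
    have := hXY v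
    rw [← Equiv.coe_toEmbedding, mem_map', mem_map']
    exact this

theorem IsPM.of_iso (e : G ≃g G') {m : V' → V'} (hm : IsPM G' univ m) :
    IsPM G univ fun v => e.symm (m (e v)) := by
  refine ⟨fun v _ => ⟨mem_univ _, ?_, ?_⟩, fun v hv => absurd (mem_univ v) hv⟩
  · rw [← e.map_adj_iff, e.apply_symm_apply]
    exact (hm.1 (e v) (mem_univ _)).2.1
  · simp [hm.apply_apply]

theorem Lonely.of_iso (e : G ≃g G') {u v : V} (h : Lonely G' (e u) (e v)) : Lonely G u v := by
  obtain ⟨h1, m, ⟨h2, h3⟩, h4⟩ := h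
  refine ⟨e.map_adj_iff.1 h1, _, ⟨h2.of_iso e, by simp [h3]⟩, ?_⟩
  rintro k ⟨hk, hku⟩
  have h5 := h4 _ ⟨hk.of_iso e.symm, by simp [hku]⟩
  funext x
  rw [← h5]
  simp

theorem lonely_iff_of_iso (e : G ≃g G') {u v : V} : Lonely G' (e u) (e v) ↔ Lonely G u v :=
  ⟨fun h => h.of_iso e, fun h => Lonely.of_iso e.symm (by simpa using h)⟩

theorem darts_eq_of_iso (e : G ≃g G') : darts G = darts G' := by
  classical
  unfold darts
  refine card_bij (fun q _ => (e q.1, e q.2)) ?_ ?_ ?_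
  · intro q hq
    simpa [lonely_iff_of_iso e] using hq
  · intro q _ q' _ h
    simpa [Prod.ext_iff] using h
  · intro q hq
    refine ⟨(e.symm q.1, e.symm q.2), ?_, by simp⟩
    simpa [← lonely_iff_of_iso e] using hq

theorem nonempty_iso_of_injective {f : V → V'} (hf : Function.Injective f)
    (hcard : Fintype.card V' = Fintype.card V) (hadj : ∀ a b, G'.Adj (f a) (f b) ↔ G.Adj a b) :
    Nonempty (G' ≃g G) := by
  have hb : Function.Bijective f := (Fintype.bijective_iff_injective_and_card f).2 ⟨hf, hcard.symm⟩
  exact ⟨(SimpleGraph.Iso.symm ⟨Equiv.ofBijective f hb, fun {a b} => hadj a b⟩)⟩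

end Iso

/-! ### Every triangle arises from an expansion -/

section Decomposition

open scoped Classical

variable {V : Type*} [Fintype V] {G : SimpleGraph V}

theorem Cubic3.four_le_card (hG : Cubic3 G) [Nonempty V] : 4 ≤ Fintype.card V := by
  have v := Classical.arbitrary V
  have h := hG.deg v
  rw [cut_singleton] at h
  have h2 : insert v (univ.filter fun y => G.Adj v y) ⊆ univ := subset_univ _
  have h3 := card_le_card h2
  rw [card_insert_of_notMem (by simp), h] at h3
  simpa using h3

theorem Cubic3.adj_of_card_eq_four (hG : Cubic3 G) (hV : Fintype.card V = 4) {u v : V}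
    (h : u ≠ v) : G.Adj u v := by
  have h1 := hG.deg u
  rw [cut_singleton] at h1
  have h2 : insert u (univ.filter fun y => G.Adj u y) = univ := by
    refine eq_univ_of_card _ ?_
    rw [card_insert_of_notMem (by simp), h1, hV]
  have h3 : v ∈ insert u (univ.filter fun y => G.Adj u y) := by
    rw [h2]
    exact mem_univ v
  simpa [h.symm] using h3

/-- Each corner has exactly one neighbour outside the triangle; what needs 3-edge-connectivity is
that these three neighbours are distinct. -/
theorem Cubic3.exists_iso_big.{u} {V : Type u} [Fintype V] {G : SimpleGraph V} (hG : Cubic3 G)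
    (hV : 4 < Fintype.card V) {x y z : V}
    (hxy : G.Adj x y) (hyz : G.Adj y z) (hxz : G.Adj x z) :
    ∃ (X : Type u) (_ : Fintype X) (K : SimpleGraph X) (p : Fin 3 → X), Function.Injective p ∧
      Nonempty (G ≃g big K p) := by
  set t : Fin 3 → V := ![x, y, z] with ht
  have htadj : ∀ i j, i ≠ j → G.Adj (t i) (t j) := by
    intro i j
    fin_cases i <;> fin_cases j <;> simp [ht, hxy, hyz, hxz, hxy.symm, hyz.symm, hxz.symm]
  have htinj : Function.Injective t := by
    intro i j h
    by_contra hne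
    exact (htadj i j hne).ne h
  set T : Finset V := univ.image t with hT
  have hmemT : ∀ v, v ∈ T ↔ ∃ i, t i = v := by simp [hT]
  have hcardT : #T = 3 := by rw [hT, card_image_of_injective _ htinj]; simp
  have hTself : cut G T T = 6 := by
    rw [hT]
    unfold cut
    rw [sum_image fun i _ j _ h => htinj h]
    have : ∀ i : Fin 3, (∑ y ∈ univ.image t, if G.Adj (t i) y then 1 else 0) = 2 := by
      intro i
      rw [sum_image fun i _ j _ h => htinj h]
      have : ∀ j, G.Adj (t i) (t j) ↔ i ≠ j :=
        fun j => ⟨fun h he => h.ne (by rw [he]), htadj i j⟩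
      simp only [this]
      revert i; simp [Fin.sum_univ_three, Fin.forall_fin_succ]
    simp [this]
  have hbT : bd G T = 3 := by
    have := hG.cut_self_add_bd T
    omega
  have hout : ∀ i, cut G {t i} Tᶜ = 1 := by
    intro i
    have h1 := hG.cut_singleton_add (t i) T
    have h2 : cut G {t i} T = 2 := by
      rw [cut_singleton]
      have : T.filter (fun y => G.Adj (t i) y) = T.erase (t i) := by
        ext v
        simp only [mem_filter, mem_erase]
        constructor
        · exact fun h => ⟨h.2.ne', h.1⟩
        · rintro ⟨h, h'⟩
          obtain ⟨j, rfl⟩ := (hmemT v).1 h'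
          exact ⟨h', htadj i j fun h'' => h (by rw [h''])⟩
      rw [this, card_erase_of_mem ((hmemT _).2 ⟨i, rfl⟩), hcardT]
    omega
  have hex : ∀ i, ∃ w : {v // v ∉ T}, ∀ v ∉ T, G.Adj (t i) v ↔ (w : V) = v := by
    intro i
    have h1 := hout i
    rw [cut_singleton, card_eq_one] at h1
    obtain ⟨w, hw⟩ := h1
    have h2 : w ∈ Tᶜ.filter (G.Adj (t i)) := by rw [hw]; simp
    refine ⟨⟨w, by simpa using (mem_filter.1 h2).1⟩, fun v hv => ?_⟩
    have h3 : v ∈ Tᶜ.filter (G.Adj (t i)) ↔ v ∈ ({w} : Finset V) := by rw [hw]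
    simp only [mem_filter, mem_compl, hv, not_false_eq_true, true_and, mem_singleton] at h3
    rw [h3, eq_comm]
  choose p hp using hex
  refine ⟨{v // v ∉ T}, inferInstance, G.comap Subtype.val, p, ?_, ?_⟩
  · intro i j hij
    -- A shared outside neighbour together with the triangle would have at most `3 + 3 - 4 = 2`
    -- leaving edges, although a fifth vertex exists.
    by_contra hne
    have hi := (hp i (p i) (p i).2).2 rfl
    have hj := (hp j (p i) (p i).2).2 (by rw [hij])
    have h1 := two_le_cut ((hmemT _).2 ⟨i, rfl⟩) ((hmemT _).2 ⟨j, rfl⟩) (htinj.ne hne) hi.symm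
      hj.symm
    have hd : Disjoint ({(p i : V)} : Finset V) T := by simpa using (p i).2
    have h2 := bd_union (G := G) hd
    rw [hG.bd_singleton] at h2
    have h3 : #({(p i : V)} ∪ T) = 4 := by rw [card_union_of_disjoint hd, hcardT]; simp
    have h4 := hG.three_le_bd (X := {(p i : V)} ∪ T) (card_pos.1 (by omega))
      (card_pos.1 (by rw [card_compl]; omega))
    omega
  · refine (nonempty_iso_of_injective (G := big (G.comap Subtype.val) p) (G' := G)
      (f := Sum.elim Subtype.val t) ?_ ?_ ?_)
    · rintro (a | i) (b | j) h
      · exact congrArg _ (Subtype.ext h)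
      · exact absurd ((hmemT _).2 ⟨j, h.symm⟩) a.2
      · exact absurd ((hmemT _).2 ⟨i, h⟩) b.2
      · exact congrArg _ (htinj h)
    · rw [Fintype.card_sum, Fintype.card_subtype_compl, Fintype.card_coe, hcardT, Fintype.card_fin]
      omega
    · rintro (a | i) (b | j)
      · simp
      · simp only [Sum.elim_inl, Sum.elim_inr, big_inl_inr]
        rw [G.adj_comm, hp j a a.2, Subtype.ext_iff]
      · simp only [Sum.elim_inl, Sum.elim_inr, big_inr_inl]
        rw [hp i b b.2, Subtype.ext_iff]
      · simp only [Sum.elim_inr, big_inr_inr]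
        exact ⟨fun h he => h.ne (by rw [he]), htadj i j⟩

end Decomposition

/-! ### Matchings and lonely edges of `K₄`, the prism and the bicorn -/

/-- The prism as a simple graph. -/
def prismGraph : SimpleGraph (Fin 6) :=
  SimpleGraph.fromEdgeSet
    {s(0, 1), s(1, 2), s(0, 2), s(3, 4), s(4, 5), s(3, 5), s(0, 3), s(1, 4), s(2, 5)}

/-- The bicorn as a simple graph. -/
def bicornGraph : SimpleGraph (Fin 8) :=
  SimpleGraph.fromEdgeSet
    {s(0, 1), s(1, 2), s(0, 2), s(0, 4), s(1, 6), s(2, 3),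
     s(3, 4), s(4, 5), s(3, 7), s(5, 6), s(5, 7), s(6, 7)}

theorem prismGraph_adj (a b : Fin 6) : prismGraph.Adj a b ↔
    b ∈ ((![{1, 2, 3}, {0, 2, 4}, {0, 1, 5}, {0, 4, 5}, {1, 3, 5}, {2, 3, 4}] :
      Fin 6 → Finset (Fin 6)) a) := by
  simp only [prismGraph, SimpleGraph.fromEdgeSet_adj, Set.mem_insert_iff, Set.mem_singleton_iff]
  revert a b
  decide +kernel

theorem bicornGraph_adj (a b : Fin 8) : bicornGraph.Adj a b ↔
    b ∈ ((![{1, 2, 4}, {0, 2, 6}, {0, 1, 3}, {2, 4, 7}, {0, 3, 5}, {4, 6, 7}, {1, 5, 7},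
      {3, 5, 6}] : Fin 8 → Finset (Fin 8)) a) := by
  simp only [bicornGraph, SimpleGraph.fromEdgeSet_adj, Set.mem_insert_iff, Set.mem_singleton_iff]
  revert a b
  decide +kernel

instance : DecidableRel prismGraph.Adj := fun a b => decidable_of_iff _ (prismGraph_adj a b).symm

instance : DecidableRel bicornGraph.Adj := fun a b => decidable_of_iff _ (bicornGraph_adj a b).symm

theorem lonely_iff_of_forall_isPM {V : Type*} [Fintype V] [DecidableEq V] {G : SimpleGraph V}
    {L : Finset (V → V)} (hL : ∀ m, IsPM G univ m ↔ m ∈ L) (a b : V) :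
    Lonely G a b ↔ G.Adj a b ∧ #(L.filter fun m => m a = b) = 1 := by
  unfold Lonely
  rw [card_eq_one]
  refine and_congr_right fun _ => ?_
  have hf : ∀ m, (IsPM G univ m ∧ m a = b) ↔ m ∈ L.filter fun m => m a = b := by
    simp [hL]
  simp only [hf]
  constructor
  · rintro ⟨m, hm, h⟩
    exact ⟨m, eq_singleton_iff_unique_mem.2 ⟨hm, h⟩⟩
  · rintro ⟨m, hm⟩
    exact ⟨m, eq_singleton_iff_unique_mem.1 hm⟩

theorem isPM_univ_iff {V : Type*} [Fintype V] {G : SimpleGraph V} (m : V → V) :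
    IsPM G univ m ↔ ∀ v, G.Adj v (m v) ∧ m (m v) = v := by
  simp [IsPM]

/-- The perfect matchings of the prism. -/
def prismPMs : Finset (Fin 6 → Fin 6) :=
  {![1, 0, 5, 4, 3, 2], ![2, 4, 0, 5, 1, 3], ![3, 2, 1, 0, 5, 4], ![3, 4, 5, 0, 1, 2]}

/-- The perfect matchings of the bicorn. -/
def bicornPMs : Finset (Fin 8 → Fin 8) :=
  {![1, 0, 3, 2, 5, 4, 7, 6], ![2, 6, 0, 4, 3, 7, 1, 5], ![2, 6, 0, 7, 5, 4, 1, 3],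
    ![4, 2, 1, 7, 0, 6, 5, 3], ![4, 6, 3, 2, 0, 7, 1, 5]}

theorem isPM_prism_iff (m : Fin 6 → Fin 6) : IsPM prismGraph univ m ↔ m ∈ prismPMs := by
  constructor
  · intro h
    rw [isPM_univ_iff] at h
    have hp : ∀ i j, m i = j ↔ m j = i := fun i j =>
      ⟨fun e => by rw [← e, (h i).2], fun e => by rw [← e, (h j).2]⟩
    have hm : m = ![m 0, m 1, m 2, m 3, m 4, m 5] := by
      funext i; fin_cases i <;> rfl
    -- Partners are chosen vertex by vertex, subject to adjacency and to symmetry with earlier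
    -- choices, so the search stays small. Symmetry is only imposed on adjacent pairs; for the
    -- others it is vacuous.
    have key : ∀ m0, prismGraph.Adj 0 m0 → ∀ m1, prismGraph.Adj 1 m1 → (m0 = 1 ↔ m1 = 0) →
      ∀ m2, prismGraph.Adj 2 m2 → (m0 = 2 ↔ m2 = 0) → (m1 = 2 ↔ m2 = 1) →
      ∀ m3, prismGraph.Adj 3 m3 → (m0 = 3 ↔ m3 = 0) →
      ∀ m4, prismGraph.Adj 4 m4 → (m1 = 4 ↔ m4 = 1) → (m3 = 4 ↔ m4 = 3) →
      ∀ m5, prismGraph.Adj 5 m5 → (m2 = 5 ↔ m5 = 2) → (m3 = 5 ↔ m5 = 3) → (m4 = 5 ↔ m5 = 4) →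
      ![m0, m1, m2, m3, m4, m5] ∈ prismPMs := by decide +kernel
    rw [hm]
    exact key _ (h 0).1 _ (h 1).1 (hp _ _) _ (h 2).1 (hp _ _) (hp _ _) _ (h 3).1 (hp _ _) _ (h 4).1
      (hp _ _) (hp _ _) _ (h 5).1 (hp _ _) (hp _ _) (hp _ _)
  · intro hm
    rw [isPM_univ_iff]
    simp only [prismPMs, mem_insert, mem_singleton] at hm
    rcases hm with rfl | rfl | rfl | rfl <;> decide +kernel

/-- Partners of the first six vertices of the bicorn extend only to perfect matchings. -/
def BicornTail₂ (m0 m1 m2 m3 m4 m5 : Fin 8) : Prop :=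
  ∀ m6 : Fin 8, bicornGraph.Adj 6 m6 ∧ (m1 = 6 ↔ m6 = 1) ∧ (m5 = 6 ↔ m6 = 5) →
  ∀ m7 : Fin 8, bicornGraph.Adj 7 m7 ∧ (m3 = 7 ↔ m7 = 3) ∧ (m5 = 7 ↔ m7 = 5) ∧
    (m6 = 7 ↔ m7 = 6) →
  ![m0, m1, m2, m3, m4, m5, m6, m7] ∈ bicornPMs

/-- Partners of the first four vertices of the bicorn extend only to perfect matchings. -/
def BicornTail (m0 m1 m2 m3 : Fin 8) : Prop :=
  ∀ m4 : Fin 8, bicornGraph.Adj 4 m4 ∧ (m0 = 4 ↔ m4 = 0) ∧ (m3 = 4 ↔ m4 = 3) →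
  ∀ m5 : Fin 8, bicornGraph.Adj 5 m5 ∧ (m4 = 5 ↔ m5 = 4) →
BicornTail₂ m0 m1 m2 m3 m4 m5

instance (m0 m1 m2 m3 m4 m5 : Fin 8) : Decidable (BicornTail₂ m0 m1 m2 m3 m4 m5) := by
  unfold BicornTail₂
  infer_instance

instance (m0 m1 m2 m3 : Fin 8) : Decidable (BicornTail m0 m1 m2 m3) := by
  unfold BicornTail
  infer_instance

theorem isPM_bicorn_iff (m : Fin 8 → Fin 8) : IsPM bicornGraph univ m ↔ m ∈ bicornPMs := by
  constructor
  · intro h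
    rw [isPM_univ_iff] at h
    have hp : ∀ i j, m i = j ↔ m j = i := fun i j =>
      ⟨fun e => by rw [← e, (h i).2], fun e => by rw [← e, (h j).2]⟩
    have hm : m = ![m 0, m 1, m 2, m 3, m 4, m 5, m 6, m 7] := by
      funext i; fin_cases i <;> rfl
    have key : ∀ m0 m1 : Fin 8, bicornGraph.Adj 0 m0 ∧ bicornGraph.Adj 1 m1 ∧ (m0 = 1 ↔ m1 = 0) →
      ∀ m2 : Fin 8, bicornGraph.Adj 2 m2 ∧ (m0 = 2 ↔ m2 = 0) ∧ (m1 = 2 ↔ m2 = 1) →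
      ∀ m3 : Fin 8, bicornGraph.Adj 3 m3 ∧ (m2 = 3 ↔ m3 = 2) →
      BicornTail m0 m1 m2 m3 := by decide +kernel
    rw [hm]
    exact key _ _ ⟨(h 0).1, (h 1).1, hp _ _⟩ _ ⟨(h 2).1, hp _ _, hp _ _⟩ _ ⟨(h 3).1, hp _ _⟩
      _ ⟨(h 4).1, hp _ _, hp _ _⟩ _ ⟨(h 5).1, hp _ _⟩ _ ⟨(h 6).1, hp _ _, hp _ _⟩
      _ ⟨(h 7).1, hp _ _, hp _ _, hp _ _⟩
  · intro hm
    rw [isPM_univ_iff]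
    simp only [bicornPMs, mem_insert, mem_singleton] at hm
    rcases hm with rfl | rfl | rfl | rfl | rfl <;> decide +kernel

theorem isPM_completeFour_iff (m : Fin 4 → Fin 4) : IsPM (⊤ : SimpleGraph (Fin 4)) univ m ↔
    m ∈ ({![1, 0, 3, 2], ![2, 3, 0, 1], ![3, 2, 1, 0]} : Finset (Fin 4 → Fin 4)) := by
  rw [isPM_univ_iff]
  revert m
  decide +kernel

theorem darts_eq_of_forall_isPM {V : Type*} [Fintype V] [DecidableEq V] {G : SimpleGraph V}
    [DecidableRel G.Adj] {L : Finset (V → V)} (hL : ∀ m, IsPM G univ m ↔ m ∈ L) :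
    darts G = #(univ.filter fun q : V × V => G.Adj q.1 q.2 ∧
      #(L.filter fun m => m q.1 = q.2) = 1) := by
  unfold darts
  congr 1
  ext q
  simp [lonely_iff_of_forall_isPM hL]

theorem darts_completeFour : darts (⊤ : SimpleGraph (Fin 4)) = 12 := by
  rw [darts_eq_of_forall_isPM isPM_completeFour_iff]
  decide +kernel

theorem darts_prism : darts prismGraph = 12 := by
  rw [darts_eq_of_forall_isPM isPM_prism_iff]
  decide +kernel

theorem darts_bicorn : darts bicornGraph = 10 := by
  rw [darts_eq_of_forall_isPM isPM_bicorn_iff]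
  decide +kernel

/-! ### The classification by expansions -/

section Classification

variable {X : Type*} [Fintype X] {K : SimpleGraph X} {p : Fin 3 → X}

theorem nonempty_big_iso_prism (hp : Function.Injective p)
    (φ : small K p ≃g (⊤ : SimpleGraph (Fin 4))) : Nonempty (big K p ≃g prismGraph) := by
  have hcard : Fintype.card X = 3 := by
    have := Fintype.card_congr φ.toEquiv
    simpa using this
  have hK : ∀ x y, K.Adj x y ↔ x ≠ y := by
    intro x y
    rw [← small_some_some (p := p), ← φ.map_adj_iff, SimpleGraph.top_adj, φ.injective.ne_iff]
    simp
  refine nonempty_iso_of_injective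
    (f := ![.inr 0, .inr 1, .inr 2, .inl (p 0), .inl (p 1), .inl (p 2)]) ?_ (by simp [hcard]) ?_
  · intro a b
    fin_cases a <;> fin_cases b <;> simp [hp.eq_iff]
  · intro a b
    rw [prismGraph_adj]
    fin_cases a <;> fin_cases b <;> simp [hK, hp.eq_iff]

/-- Automorphisms of the prism moving the vertex `0` to any given vertex. -/
def prismAut : Fin 6 → Fin 6 → Fin 6 :=
  ![![0, 1, 2, 3, 4, 5], ![1, 2, 0, 4, 5, 3], ![2, 0, 1, 5, 3, 4], ![3, 4, 5, 0, 1, 2],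
    ![4, 5, 3, 1, 2, 0], ![5, 3, 4, 2, 0, 1]]

theorem prismAut_spec : ∀ i, prismAut i 0 = i ∧ (∀ a b, prismAut i a = prismAut i b → a = b) ∧
    ∀ a b, prismGraph.Adj (prismAut i a) (prismAut i b) ↔ prismGraph.Adj a b := by
  decide +kernel

/-- Vertex-transitivity of the prism allows the contracted vertex to be taken as `0`, which leaves a
single expansion to identify. -/
theorem nonempty_big_iso_bicorn (φ : small K p ≃g prismGraph) : Nonempty (big K p ≃g bicornGraph) := by
  have hcard : Fintype.card X = 5 := by
    have := Fintype.card_congr φ.toEquiv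
    simpa using this
  obtain ⟨h0, hinj, hadj⟩ := prismAut_spec (φ none)
  have hψ0 : φ.symm (prismAut (φ none) 0) = none := by rw [h0, φ.symm_apply_apply]
  have hψinj : ∀ a b, φ.symm (prismAut (φ none) a) = φ.symm (prismAut (φ none) b) → a = b :=
    fun a b h => hinj a b (φ.symm.injective h)
  have hψ : ∀ a b, (small K p).Adj (φ.symm (prismAut (φ none) a))
      (φ.symm (prismAut (φ none) b)) ↔ prismGraph.Adj a b := fun a b => by
    rw [φ.symm.map_adj_iff, hadj]
  generalize prismAut (φ none) = σ at *
  have hx : ∀ a : Fin 5, ∃ x, φ.symm (σ a.succ) = some x := by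
    intro a
    rw [← Option.ne_none_iff_exists']
    intro h
    exact Fin.succ_ne_zero a (hψinj _ _ (h.trans hψ0.symm))
  choose x hx using hx
  have hxinj : Function.Injective x := by
    intro a b h
    have := hψinj a.succ b.succ (by rw [hx, hx, h])
    simpa using this
  have hK : ∀ a b, K.Adj (x a) (x b) ↔ prismGraph.Adj a.succ b.succ := by
    intro a b
    rw [← hψ, hx, hx, small_some_some]
  have hN : ∀ a : Fin 5, (∃ i, p i = x a) ↔ prismGraph.Adj 0 a.succ := by
    intro a
    rw [← hψ, hψ0, hx, small_none_some]
  -- The successors of `0`, `1`, `2` in `Fin 5` are the neighbours `1`, `2`, `3` of the prism vertex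
  -- `0`.
  obtain ⟨i0, hi0⟩ := (hN 0).2 (by decide)
  obtain ⟨i1, hi1⟩ := (hN 1).2 (by decide)
  obtain ⟨i2, hi2⟩ := (hN 2).2 (by decide)
  have h01 : i0 ≠ i1 := fun h => absurd (hxinj (hi0.symm.trans (h ▸ hi1))) (by decide)
  have h02 : i0 ≠ i2 := fun h => absurd (hxinj (hi0.symm.trans (h ▸ hi2))) (by decide)
  have h12 : i1 ≠ i2 := fun h => absurd (hxinj (hi1.symm.trans (h ▸ hi2))) (by decide)
  -- The new triangle becomes `012`. The old prism vertices `1`, `2`, `3`, `4`, `5` become the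
  -- bicorn vertices `4`, `3`, `6`, `5`, `7`.
  have hf : ∀ a b : Fin 8, (big K p).Adj
      ((![.inr i0, .inr i2, .inr i1, .inl (x 1), .inl (x 0), .inl (x 3), .inl (x 2), .inl (x 4)] :
        Fin 8 → X ⊕ Fin 3) a)
      ((![.inr i0, .inr i2, .inr i1, .inl (x 1), .inl (x 0), .inl (x 3), .inl (x 2), .inl (x 4)] :
        Fin 8 → X ⊕ Fin 3) b) ↔ bicornGraph.Adj a b := by
    intro a b
    rw [bicornGraph_adj]
    fin_cases a <;> fin_cases b <;>
      simp [hK, hi0, hi1, hi2, h01, h02, h12, h01.symm, h02.symm, h12.symm, hxinj.eq_iff,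
        prismGraph_adj]
  refine nonempty_iso_of_injective ?_ (by simp [hcard]) hf
  intro a b
  fin_cases a <;> fin_cases b <;>
    simp [h01, h02, h12, h01.symm, h02.symm, h12.symm, hxinj.eq_iff]

/-- For each vertex `z` of the bicorn, a perfect matching of the non-neighbours of `z`. -/
def bicornPartner : Fin 8 → Fin 8 → Fin 8 :=
  ![![0, 1, 2, 7, 4, 6, 5, 3], ![0, 1, 2, 4, 3, 7, 6, 5], ![0, 1, 2, 3, 5, 4, 7, 6],
    ![1, 0, 2, 3, 4, 6, 5, 7], ![0, 2, 1, 3, 4, 5, 7, 6], ![1, 0, 3, 2, 4, 5, 6, 7],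
    ![2, 1, 0, 4, 3, 5, 6, 7], ![4, 2, 1, 3, 0, 5, 6, 7]]

/-- A vertex whose edge in the matching `bicornPartner z` is lonely. -/
def bicornEnd : Fin 8 → Fin 8 := ![5, 3, 6, 0, 1, 0, 3, 1]

theorem bicornPartner_spec : ∀ z v, v ≠ z ∧ ¬ bicornGraph.Adj z v →
    (bicornPartner z v ≠ z ∧ ¬ bicornGraph.Adj z (bicornPartner z v)) ∧
    bicornGraph.Adj v (bicornPartner z v) ∧ bicornPartner z (bicornPartner z v) = v := by
  decide +kernel

theorem bicornEnd_spec : ∀ z, bicornEnd z ≠ z ∧ ¬ bicornGraph.Adj z (bicornEnd z) := by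
  decide +kernel

theorem lonely_bicornEnd (z : Fin 8) :
    Lonely bicornGraph (bicornEnd z) (bicornPartner z (bicornEnd z)) := by
  rw [lonely_iff_of_forall_isPM isPM_bicorn_iff]
  revert z
  decide +kernel

/-- Whichever vertex `z` is expanded, `bicornPartner z` matches all vertices other than `z` and its
neighbours and contains a lonely edge. That edge is lost, so at most `10 - 2` darts survive. -/
theorem darts_big_le_eight (hG : Cubic3 (big K p)) (hp : Function.Injective p)
    (φ : small K p ≃g bicornGraph) : darts (big K p) ≤ 8 := by
  classical
  set z := φ none with hz
  have hW : ∀ x, (∀ i, p i ≠ x) ↔ φ (some x) ≠ z ∧ ¬ bicornGraph.Adj z (φ (some x)) := by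
    intro x
    rw [hz, φ.map_adj_iff, small_none_some]
    simp
  have hpre : ∀ v, v ≠ z ∧ ¬ bicornGraph.Adj z v → ∃ y, φ (some y) = v ∧ ∀ i, p i ≠ y := by
    intro v hv
    obtain ⟨_ | y, hy⟩ := φ.surjective v
    · exact absurd hy.symm hv.1
    · exact ⟨y, hy, (hW y).2 (hy ▸ hv)⟩
  -- The default of `getD` is never reached: the partner avoids `z`, so its preimage under `φ` is
  -- not `none`.
  let n : X → X := fun x => if ∀ i, p i ≠ x then
    (φ.symm (bicornPartner z (φ (some x)))).getD x else x
  have hn : ∀ x, (∀ i, p i ≠ x) →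
      (∀ i, p i ≠ n x) ∧ φ (some (n x)) = bicornPartner z (φ (some x)) := by
    intro x hx
    obtain ⟨y, hy, hy'⟩ := hpre _ (bicornPartner_spec z _ ((hW x).1 hx)).1
    have : n x = y := by
      simp only [n]
      rw [if_pos hx, ← hy, φ.symm_apply_apply, Option.getD_some]
    rw [this]
    exact ⟨hy', hy⟩
  have hnPM : IsPM K (univ.filter fun z => ∀ i, p i ≠ z) n := by
    refine ⟨fun x hx => ?_, fun x hx => ?_⟩
    · have hx' : ∀ i, p i ≠ x := by simpa using hx
      obtain ⟨h1, h2⟩ := hn x hx'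
      obtain ⟨-, h3, h4⟩ := bicornPartner_spec z _ ((hW x).1 hx')
      refine ⟨by simpa using h1, ?_, ?_⟩
      · rw [← small_some_some (p := p), ← φ.map_adj_iff, h2]
        exact h3
      · have h5 := (hn _ h1).2
        rw [h2, h4] at h5
        exact Option.some_injective _ (φ.injective h5)
    · have hx' : ¬ ∀ i, p i ≠ x := by simpa using hx
      simp only [n]
      rw [if_neg hx']
  obtain ⟨x, hx, hx'⟩ := hpre _ (bicornEnd_spec z)
  have hl : Lonely (small K p) (some x) (some (n x)) := by
    refine Lonely.of_iso φ ?_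
    rw [(hn x hx').2, hx]
    exact lonely_bicornEnd z
  have h1 := darts_big_add_two_le hG hp hnPM hx' rfl hl
  rw [darts_eq_of_iso φ, darts_bicorn] at h1
  omega

theorem Cubic3.nonempty_iso_completeFour {V : Type*} [Fintype V] {G : SimpleGraph V}
    (hG : Cubic3 G) (hV : Fintype.card V = 4) : Nonempty (G ≃g (⊤ : SimpleGraph (Fin 4))) := by
  let e := Fintype.equivFinOfCardEq hV
  refine nonempty_iso_of_injective (f := e.symm) e.symm.injective (by simp [hV]) ?_
  intro a b
  rw [SimpleGraph.top_adj, ← e.symm.injective.ne_iff]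
  exact ⟨fun h => h.ne, hG.adj_of_card_eq_four hV⟩

/-- The classification of cubic 3-edge-connected graphs with many lonely edges. -/
theorem Cubic3.classification.{u} : ∀ (n : ℕ) (V : Type u) [Fintype V] (G : SimpleGraph V),
    Fintype.card V = n → Cubic3 G → (∃ u v, Lonely G u v) →
    Nonempty (G ≃g (⊤ : SimpleGraph (Fin 4))) ∨ Nonempty (G ≃g prismGraph) ∨
      Nonempty (G ≃g bicornGraph) ∨ darts G ≤ 8 := by
  intro n
  induction n using Nat.strong_induction_on with
  | _ n ih =>
  intro V _ G hn hG hl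
  obtain ⟨u, v, huv⟩ := hl
  have : Nonempty V := ⟨u⟩
  rcases Nat.lt_or_ge 4 (Fintype.card V) with h4 | h4
  · obtain ⟨x, y, z, hxy, hyz, hxz⟩ := hG.exists_triangle huv h4
    obtain ⟨X, _, K, p, hp, ⟨e⟩⟩ := hG.exists_iso_big h4 hxy hyz hxz
    have hbig : Cubic3 (big K p) := hG.of_iso e.symm
    have hcard := Fintype.card_congr e.toEquiv
    rw [Fintype.card_sum, Fintype.card_fin] at hcard
    have hlb : Lonely (big K p) (e u) (e v) := (lonely_iff_of_iso e).2 huv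
    have hls := exists_lonely_small hbig hp ⟨_, _, hlb⟩
    rcases ih (Fintype.card (Option X)) (by rw [Fintype.card_option]; omega) (Option X)
      (LonelyEdge.small K p) rfl (hbig.small hp) hls with ⟨⟨φ⟩⟩ | ⟨⟨φ⟩⟩ | ⟨⟨φ⟩⟩ | h
    · obtain ⟨ψ⟩ := nonempty_big_iso_prism hp φ
      exact Or.inr (Or.inl ⟨e.trans ψ⟩)
    · obtain ⟨ψ⟩ := nonempty_big_iso_bicorn φ
      exact Or.inr (Or.inr (Or.inl ⟨e.trans ψ⟩))
    · refine Or.inr (Or.inr (Or.inr ?_))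
      rw [darts_eq_of_iso e]
      exact darts_big_le_eight hbig hp φ
    · refine Or.inr (Or.inr (Or.inr ?_))
      rw [darts_eq_of_iso e]
      exact (darts_big_le hbig hp).trans h
  · exact Or.inl (hG.nonempty_iso_completeFour (le_antisymm h4 hG.four_le_card))

end Classification

/-! ### From vertex-connectivity to edge-connectivity -/

open scoped Graph

/-- A simple graph has more than three vertices and stays connected when fewer than three vertices
are deleted: any two disjoint nonempty sets without edges between them miss three vertices. -/
def VertexConnected3 {V : Type*} [Fintype V] (H : SimpleGraph V) : Prop :=
  3 < Fintype.card V ∧ ∀ P Q : Finset V, P.Nonempty → Q.Nonempty → Disjoint P Q →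
    (∀ x ∈ P, ∀ y ∈ Q, ¬ H.Adj x y) → #P + #Q + 3 ≤ Fintype.card V

open scoped Classical in
-- Given a cut of at most two edges, both sides have at least two vertices. Delete one end `x` of a
-- cut edge in `X`, and in `Y` the ends of the other cut edges that do not start at `x`: at most two
-- vertices are removed, both sides survive, and no edge joins them.
theorem VertexConnected3.cubic3 {V : Type*} [Fintype V] {H : SimpleGraph V}
    (hH : VertexConnected3 H) (hdeg : ∀ v, cut H {v} univ = 3) : Cubic3 H := by
  refine ⟨hdeg, fun X Y hX hY hXY => ?_⟩
  have hd : Disjoint X Y := Finset.disjoint_left.2 fun v hv => (hXY v).1 hv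
  have hU : X ∪ Y = univ := by
    ext v
    have := hXY v
    simp only [mem_union, mem_univ, iff_true]; tauto
  have hcard : #X + #Y = Fintype.card V := by
    rw [← card_union_of_disjoint hd, hU, card_univ]
  have hself : ∀ v, cut H {v} X + cut H {v} Y = 3 := fun v => by
    rw [← cut_union_right hd, hU, hdeg]
  by_contra! hlt
  have hone : ∀ A B : Finset V, cut H A B < 3 → (∀ v, cut H {v} A + cut H {v} B = 3) →
      A.Nonempty → 2 ≤ #A := by
    intro A B hAB hs hA
    by_contra! hA2
    obtain ⟨a, rfl⟩ := card_eq_one.1 (by have := card_pos.2 hA; omega : #A = 1)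
    have := hs a
    rw [cut_singleton_self] at this
    omega
  have hX2 := hone X Y hlt hself hX
  have hY2 := hone Y X (by rwa [cut_comm]) (fun v => by rw [add_comm]; exact hself v) hY
  by_cases h0 : cut H X Y = 0
  · have := hH.2 X Y hX hY hd (cut_eq_zero_iff.1 h0)
    omega
  obtain ⟨x, hx, y, hy, hxy⟩ : ∃ x ∈ X, ∃ y ∈ Y, H.Adj x y := by
    by_contra! hno
    exact h0 (cut_eq_zero_iff.2 hno)
  have h1 : cut H {x} Y + cut H (X.erase x) Y = cut H X Y := by
    rw [← cut_union_left (by simp), ← insert_eq, insert_erase hx]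
  have h2 := cut_pos (X := {x}) (by simp) hy hxy
  set B := Y.filter fun v => ∃ u ∈ X.erase x, H.Adj u v with hB
  have hBcard : #B ≤ cut H (X.erase x) Y := by
    have h3 : cut H Y (X.erase x) = ∑ v ∈ Y, cut H {v} (X.erase x) := cut_eq_sum _ _
    rw [cut_comm, h3, card_eq_sum_ones]
    refine (sum_le_sum fun v hv => ?_).trans (sum_le_sum_of_subset (filter_subset _ Y))
    obtain ⟨-, u, hu, huv⟩ := mem_filter.1 hv
    exact cut_pos (by simp) hu huv.symm
  have h4 : #(X.erase x) + 1 = #X := card_erase_add_one hx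
  have h5 : #(Y \ B) + #B = #Y := card_sdiff_add_card_eq_card (filter_subset _ _)
  have h6 := hH.2 (X.erase x) (Y \ B) (card_pos.1 (by omega)) (card_pos.1 (by omega))
    (hd.mono (erase_subset _ _) sdiff_subset) (by
      intro u hu v hv huv
      rw [mem_sdiff, hB, mem_filter] at hv
      exact hv.2 ⟨hv.1, u, hu, huv⟩)
  omega

/-! ### Multigraphs represented by simple graphs -/

section Representation

variable {α β V : Type*} {G : Graph α β} {H : SimpleGraph V}

/-- Bijections identifying the multigraph `G` with the simple graph `H`. -/
structure Rep (G : Graph α β) (H : SimpleGraph V) where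
  /-- The bijection between the vertices. -/
  φ : V(G) ≃ V
  /-- The bijection between the edges. -/
  ψ : E(G) ≃ H.edgeSet
  isLink_iff : ∀ (e : E(G)) (x y : V(G)), G.IsLink e x y ↔ (ψ e : Sym2 V) = s(φ x, φ y)

theorem isIsomorphic_ofSimpleGraph_iff :
    G.IsIsomorphic (Graph.ofSimpleGraph H) ↔ Nonempty (Rep G H) := by
  constructor
  · rintro ⟨φ, ψ, h⟩
    refine ⟨⟨φ.trans (Equiv.Set.univ V), ψ, fun e x y => ?_⟩⟩
    rw [h]
    exact ⟨fun h => h.1, fun h => ⟨h, (ψ e).2⟩⟩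
  · rintro ⟨φ, ψ, h⟩
    refine ⟨φ.trans (Equiv.Set.univ V).symm, ψ, fun e x y => ?_⟩
    rw [h]
    exact ⟨fun h => ⟨h, (ψ e).2⟩, fun h => h.1⟩

/-- Transport of a representation along an isomorphism of simple graphs. -/
def Rep.trans {V' : Type*} {H' : SimpleGraph V'} (r : Rep G H) (e : H ≃g H') : Rep G H' where
  φ := r.φ.trans e.toEquiv
  ψ := r.ψ.trans e.mapEdgeSet
  isLink_iff f x y := by
    rw [r.isLink_iff]
    change _ ↔ Sym2.map e (r.ψ f : Sym2 V) = Sym2.map e s(r.φ x, r.φ y)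
    rw [(Sym2.map.injective e.injective).eq_iff]

namespace Rep

theorem exists_edge (r : Rep G H) {a b : V} (h : H.Adj a b) : ∃ e : E(G), (r.ψ e : Sym2 V) = s(a, b) :=
  ⟨r.ψ.symm ⟨s(a, b), h⟩, by simp⟩

theorem adj_of_eq (r : Rep G H) {e : E(G)} {a b : V} (h : (r.ψ e : Sym2 V) = s(a, b)) : H.Adj a b := by
  have := (r.ψ e).2
  rwa [h, SimpleGraph.mem_edgeSet] at this

theorem adj_iff (r : Rep G H) (x y : V(G)) : G.Adj x y ↔ H.Adj (r.φ x) (r.φ y) := by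
  constructor
  · rintro ⟨e, he⟩
    exact r.adj_of_eq ((r.isLink_iff ⟨e, he.edge_mem⟩ x y).1 he)
  · intro h
    obtain ⟨e, he⟩ := r.exists_edge h
    exact ⟨e, (r.isLink_iff e x y).2 he⟩

theorem inc_iff (r : Rep G H) (e : E(G)) (x : V(G)) : G.Inc e x ↔ r.φ x ∈ (r.ψ e : Sym2 V) := by
  rw [Sym2.mem_iff_exists]
  constructor
  · rintro ⟨y, hy⟩
    exact ⟨r.φ ⟨y, hy.right_mem⟩, (r.isLink_iff e x ⟨y, hy.right_mem⟩).1 hy⟩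
  · rintro ⟨b, hb⟩
    exact ⟨r.φ.symm b, (r.isLink_iff e x (r.φ.symm b)).2 (by simpa using hb)⟩

theorem loopless (r : Rep G H) : G.Loopless := by
  refine ⟨fun e x hx => ?_⟩
  have hx' : G.IsLink e x x := hx
  have := r.adj_of_eq ((r.isLink_iff ⟨e, hx'.edge_mem⟩ ⟨x, hx'.left_mem⟩ ⟨x, hx'.left_mem⟩).1 hx')
  exact H.irrefl this

theorem encard_incidenceSet [Fintype V] (r : Rep G H) (x : V(G)) :
    (G.incidenceSet x).encard = cut H {r.φ x} univ := by
  classical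
  have h1 : G.incidenceSet x = (fun y : H.neighborSet (r.φ x) =>
      (r.ψ.symm ⟨s(r.φ x, y), y.2⟩ : β)) '' Set.univ := by
    ext e
    simp only [Set.image_univ, Set.mem_range, Graph.mem_incidenceSet]
    constructor
    · intro he
      have h2 := (r.inc_iff ⟨e, he.edge_mem⟩ x).1 he
      rw [Sym2.mem_iff_exists] at h2
      obtain ⟨b, hb⟩ := h2
      refine ⟨⟨b, r.adj_of_eq hb⟩, ?_⟩
      have : r.ψ.symm ⟨s(r.φ x, b), r.adj_of_eq hb⟩ = ⟨e, he.edge_mem⟩ := by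
        rw [Equiv.symm_apply_eq]
        exact Subtype.ext hb.symm
      rw [this]
    · rintro ⟨y, rfl⟩
      rw [r.inc_iff, Equiv.apply_symm_apply]
      simp
  rw [h1, Function.Injective.encard_image, Set.encard_univ, ENat.card_eq_coe_fintype_card,
    cut_singleton]
  · congr 1
    rw [Fintype.card_subtype]
    congr 1
  · intro y z h
    have h2 := r.ψ.symm.injective (Subtype.ext h)
    have h3 : s(r.φ x, (y : V)) = s(r.φ x, (z : V)) := congrArg Subtype.val h2
    exact Subtype.ext (Sym2.congr_right.1 h3)

theorem isCubic_iff [Fintype V] (r : Rep G H) : G.IsCubic ↔ ∀ v, cut H {v} univ = 3 := by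
  constructor
  · rintro ⟨-, h⟩ v
    have h1 := h _ (r.φ.symm v).2
    rw [r.encard_incidenceSet, r.φ.apply_symm_apply] at h1
    exact_mod_cast h1
  · intro h
    refine ⟨r.loopless, fun x hx => ?_⟩
    rw [r.encard_incidenceSet ⟨x, hx⟩, h]
    rfl

theorem encard_vertexSet [Fintype V] (r : Rep G H) : V(G).encard = Fintype.card V := by
  rw [← ENat.card_coe_set_eq, ENat.card_congr r.φ, ENat.card_eq_coe_fintype_card]

theorem encard_preimage [Fintype V] (r : Rep G H) (S : Finset V) :
    {x : α | ∃ h : x ∈ V(G), r.φ ⟨x, h⟩ ∈ S}.encard = #S := by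
  have h1 : {x : α | ∃ h : x ∈ V(G), r.φ ⟨x, h⟩ ∈ S} =
      (fun v => (r.φ.symm v : α)) '' (S : Set V) := by
    ext x
    simp only [Set.mem_ofPred_eq, Set.mem_image, mem_coe]
    constructor
    · rintro ⟨h, hS⟩
      exact ⟨_, hS, by simp⟩
    · rintro ⟨v, hv, rfl⟩
      exact ⟨(r.φ.symm v).2, by simpa using hv⟩
  rw [h1, Function.Injective.encard_image (show Function.Injective fun v => (r.φ.symm v : α) from
    Subtype.val_injective.comp r.φ.symm.injective),
    Set.encard_coe_eq_coe_finsetCard]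

/-- Two nonadjacent parts are separated by deleting everything outside them; conversely, a failure
of connectedness separates the surviving vertices by reachability. -/
theorem isVertexConnected_iff [Fintype V] (r : Rep G H) : G.IsVertexConnected 3 ↔ VertexConnected3 H := by
  classical
  unfold Graph.IsVertexConnected VertexConnected3
  rw [r.encard_vertexSet]
  refine ⟨fun ⟨h3, h⟩ => ⟨by exact_mod_cast h3, fun P Q hP hQ hPQ hadj => ?_⟩,
    fun ⟨h3, h⟩ => ⟨by exact_mod_cast h3, fun X hX hX3 => ?_⟩⟩
  · by_contra! hlt
    set X := {x : α | ∃ h : x ∈ V(G), r.φ ⟨x, h⟩ ∈ (P ∪ Q)ᶜ} with hXdef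
    have hX : X.encard < (3 : ℕ) := by
      rw [r.encard_preimage, card_compl, card_union_of_disjoint hPQ]
      norm_cast
      omega
    obtain ⟨-, hconn⟩ := h X (fun x hx => hx.1) hX
    obtain ⟨p, hp⟩ := hP
    obtain ⟨q, hq⟩ := hQ
    have hmem : ∀ v ∈ P ∪ Q, (r.φ.symm v : α) ∈ V(G.deleteVerts X) := by
      intro v hv
      rw [Graph.vertexSet_deleteVerts]
      refine ⟨(r.φ.symm v).2, ?_⟩
      rintro ⟨h1, h2⟩
      simp only [Subtype.coe_eta, Equiv.apply_symm_apply, mem_compl] at h2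
      exact h2 hv
    have hwalk := hconn _ (hmem p (mem_union_left _ hp)) _ (hmem q (mem_union_right _ hq))
    have hinv : ∀ z, Relation.ReflTransGen (G.deleteVerts X).Adj (r.φ.symm p : α) z →
        ∃ hz : z ∈ V(G), r.φ ⟨z, hz⟩ ∈ P := by
      intro z hz
      induction hz with
      | refl => exact ⟨(r.φ.symm p).2, by simpa using hp⟩
      | tail _ hab ih =>
        obtain ⟨ha, haP⟩ := ih
        obtain ⟨e, he⟩ := hab
        rw [Graph.deleteVerts_isLink] at he
        refine ⟨he.1.right_mem, ?_⟩
        by_contra hbP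
        have h1 := (r.adj_iff ⟨_, he.1.left_mem⟩ ⟨_, he.1.right_mem⟩).1 ⟨e, he.1⟩
        refine hadj _ haP (r.φ ⟨_, he.1.right_mem⟩) ?_ h1
        by_contra hbQ
        refine he.2.2 ⟨he.1.right_mem, ?_⟩
        rw [mem_compl, mem_union]
        tauto
    obtain ⟨_, h1⟩ := hinv _ hwalk
    simp only [Subtype.coe_eta, Equiv.apply_symm_apply] at h1
    exact Finset.disjoint_left.1 hPQ h1 hq
  · have hXfin : #(univ.filter fun v => (r.φ.symm v : α) ∈ X) < 3 := by
      have h1 : {x : α | ∃ h : x ∈ V(G), r.φ ⟨x, h⟩ ∈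
          univ.filter fun v => (r.φ.symm v : α) ∈ X} = X := by
        ext x
        simp only [mem_filter, mem_univ, true_and, Equiv.symm_apply_apply, Set.mem_ofPred_eq,
          exists_prop, and_iff_right_iff_imp]
        exact fun hx => hX hx
      rw [← h1, r.encard_preimage] at hX3
      exact_mod_cast hX3
    have hmem : ∀ v, v ∉ (univ.filter fun v => (r.φ.symm v : α) ∈ X) →
        (r.φ.symm v : α) ∈ V(G.deleteVerts X) := by
      intro v hv
      rw [Graph.vertexSet_deleteVerts]
      exact ⟨(r.φ.symm v).2, by simpa using hv⟩
    constructor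
    · obtain ⟨v, -, hv⟩ := exists_mem_notMem_of_card_lt_card
        (show #(univ.filter fun v => (r.φ.symm v : α) ∈ X) < #(univ : Finset V) by
          rw [card_univ]; omega)
      exact ⟨_, hmem v hv⟩
    · intro x hx y hy
      rw [Graph.vertexSet_deleteVerts] at hx hy
      by_contra hxy
      -- The two parts are the surviving vertices reachable from `x` and those that are not.
      set R : V → Prop := fun v => Relation.ReflTransGen (G.deleteVerts X).Adj x (r.φ.symm v)
      have h4 := h (univ.filter fun v => (r.φ.symm v : α) ∉ X ∧ R v)
        (univ.filter fun v => (r.φ.symm v : α) ∉ X ∧ ¬ R v) ?_ ?_ ?_ ?_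
      · have h5 : univ = (univ.filter fun v => (r.φ.symm v : α) ∈ X) ∪
            ((univ.filter fun v => (r.φ.symm v : α) ∉ X ∧ R v) ∪
              univ.filter fun v => (r.φ.symm v : α) ∉ X ∧ ¬ R v) := by
          ext v
          simp only [mem_univ, mem_union, mem_filter, true_and, true_iff]
          tauto
        have h6 := congrArg Finset.card h5
        rw [card_univ] at h6
        have h7 := card_union_le (univ.filter fun v => (r.φ.symm v : α) ∈ X)
          ((univ.filter fun v => (r.φ.symm v : α) ∉ X ∧ R v) ∪
              univ.filter fun v => (r.φ.symm v : α) ∉ X ∧ ¬ R v)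
        have h8 := card_union_le (univ.filter fun v => (r.φ.symm v : α) ∉ X ∧ R v)
          (univ.filter fun v => (r.φ.symm v : α) ∉ X ∧ ¬ R v)
        omega
      · refine ⟨r.φ ⟨x, hx.1⟩, ?_⟩
        simp only [mem_filter, mem_univ, true_and, Equiv.symm_apply_apply, R]
        exact ⟨hx.2, Relation.ReflTransGen.refl⟩
      · refine ⟨r.φ ⟨y, hy.1⟩, ?_⟩
        simp only [mem_filter, mem_univ, true_and, Equiv.symm_apply_apply, R]
        exact ⟨hy.2, hxy⟩
      · rw [Finset.disjoint_left]
        intro v hv hv'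
        rw [mem_filter] at hv hv'
        exact hv'.2.2 hv.2.2
      · intro v hv w hw hvw
        rw [mem_filter] at hv hw
        refine hw.2.2 (hv.2.2.tail ?_)
        obtain ⟨e, he⟩ := (r.adj_iff (r.φ.symm v) (r.φ.symm w)).2 (by simpa using hvw)
        exact ⟨e, (Graph.deleteVerts_isLink _ _).2 ⟨he, hv.2.1, hw.2.1⟩⟩

end Rep

end Representation

/-! ### Lonely edges of the multigraph and of its simple model -/

section Lonely

variable {α β V : Type*} [Fintype V] {G : Graph α β} {H : SimpleGraph V}

/-- The edges of `G` used by a matching of `H` given as a map. -/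
def Rep.edgesOf (r : Rep G H) (m : V → V) : Set β :=
  {e | ∃ (he : e ∈ E(G)) (v : V), (r.ψ ⟨e, he⟩ : Sym2 V) = s(v, m v)}

theorem Rep.mem_edgesOf_iff (r : Rep G H) {m : V → V} (hm : IsPM H univ m) {e : E(G)} {u v : V}
    (he : (r.ψ e : Sym2 V) = s(u, v)) : (e : β) ∈ r.edgesOf m ↔ m u = v := by
  constructor
  · rintro ⟨_, w, hw⟩
    rw [Subtype.coe_eta, he, Sym2.eq_iff] at hw
    rcases hw with ⟨rfl, h⟩ | ⟨h, rfl⟩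
    · exact h.symm
    · rw [h, hm.apply_apply]
  · rintro rfl
    exact ⟨e.2, u, he⟩

theorem Rep.isPerfectMatching_edgesOf (r : Rep G H) {m : V → V} (hm : IsPM H univ m) :
    G.IsPerfectMatching (r.edgesOf m) := by
  refine ⟨fun e he => he.1, fun x hx => ?_⟩
  obtain ⟨e, he⟩ := r.exists_edge (hm.1 (r.φ ⟨x, hx⟩) (mem_univ _)).2.1
  refine ⟨e, ⟨(r.mem_edgesOf_iff hm he).2 rfl, ?_⟩, ?_⟩
  · exact (r.inc_iff e ⟨x, hx⟩).2 (by rw [he]; simp)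
  · rintro f ⟨hf, hfx⟩
    have h1 := (r.inc_iff ⟨f, hf.1⟩ ⟨x, hx⟩).1 hfx
    rw [Sym2.mem_iff_exists] at h1
    obtain ⟨b, hb⟩ := h1
    have h2 := (r.mem_edgesOf_iff hm hb).1 hf
    have h3 : r.ψ ⟨f, hf.1⟩ = r.ψ e := Subtype.ext (by rw [hb, he, h2])
    exact congrArg Subtype.val (r.ψ.injective h3)

theorem Rep.exists_eq_edgesOf (r : Rep G H) {M : Set β} (hM : G.IsPerfectMatching M) :
    ∃ m, IsPM H univ m ∧ M = r.edgesOf m := by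
  have h1 : ∀ v : V, ∃ e : E(G), ∃ w, (e : β) ∈ M ∧ (r.ψ e : Sym2 V) = s(v, w) := by
    intro v
    obtain ⟨e, ⟨he, hev⟩, -⟩ := hM.2 (r.φ.symm v) (r.φ.symm v).2
    have h2 := (r.inc_iff ⟨e, hev.edge_mem⟩ (r.φ.symm v)).1 hev
    rw [r.φ.apply_symm_apply, Sym2.mem_iff_exists] at h2
    obtain ⟨w, hw⟩ := h2
    exact ⟨⟨e, hev.edge_mem⟩, w, he, hw⟩
  choose e m heM hem using h1
  have huniq : ∀ (f : E(G)) (v w : V), (f : β) ∈ M → (r.ψ f : Sym2 V) = s(v, w) → f = e v := by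
    intro f v w hf hfv
    have hinc : ∀ (f : E(G)) w, (r.ψ f : Sym2 V) = s(v, w) → G.Inc f (r.φ.symm v) := by
      intro f w hf
      rw [r.inc_iff, hf]
      simp
    exact Subtype.ext ((hM.2 (r.φ.symm v) (r.φ.symm v).2).unique ⟨hf, hinc f w hfv⟩
      ⟨heM v, hinc _ _ (hem v)⟩)
  refine ⟨m, ⟨fun v _ => ⟨mem_univ _, r.adj_of_eq (hem v), ?_⟩, fun v hv => absurd (mem_univ v) hv⟩,
    ?_⟩
  · have h2 : (r.ψ (e v) : Sym2 V) = s(m v, v) := by rw [hem, Sym2.eq_swap]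
    have h3 := huniq (e v) (m v) v (heM v) h2
    rw [h3, hem] at h2
    exact Sym2.congr_right.1 h2
  · ext f
    constructor
    · intro hf
      have hfE := hM.1 hf
      obtain ⟨a, b, hab⟩ : ∃ a b, (r.ψ ⟨f, hfE⟩ : Sym2 V) = s(a, b) := by
        induction (r.ψ ⟨f, hfE⟩ : Sym2 V) with | _ a b => exact ⟨a, b, rfl⟩
      refine ⟨hfE, a, ?_⟩
      rw [huniq ⟨f, hfE⟩ a b hf hab, hem]
    · rintro ⟨hfE, v, hv⟩
      have h2 : (⟨f, hfE⟩ : E(G)) = e v := r.ψ.injective (Subtype.ext (by rw [hv, hem]))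
      have h3 := heM v
      rwa [← h2] at h3

theorem Rep.edgesOf_injective (r : Rep G H) {m m' : V → V} (hm : IsPM H univ m)
    (hm' : IsPM H univ m') (h : r.edgesOf m = r.edgesOf m') : m = m' := by
  funext v
  obtain ⟨e, he⟩ := r.exists_edge (hm.1 v (mem_univ _)).2.1
  have h1 := (r.mem_edgesOf_iff hm he).2 rfl
  rw [h] at h1
  exact ((r.mem_edgesOf_iff hm' he).1 h1).symm

theorem Rep.isLonely_iff (r : Rep G H) {e : E(G)} {u v : V} (he : (r.ψ e : Sym2 V) = s(u, v)) :
    G.IsLonely e ↔ Lonely H u v := by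
  constructor
  · rintro ⟨-, M, ⟨hM, heM⟩, huniq⟩
    obtain ⟨m, hm, rfl⟩ := r.exists_eq_edgesOf hM
    refine ⟨r.adj_of_eq he, m, ⟨hm, (r.mem_edgesOf_iff hm he).1 heM⟩, ?_⟩
    rintro m' ⟨hm', hu⟩
    exact r.edgesOf_injective hm' hm
      (huniq _ ⟨r.isPerfectMatching_edgesOf hm', (r.mem_edgesOf_iff hm' he).2 hu⟩)
  · rintro ⟨-, m, ⟨hm, hu⟩, huniq⟩
    refine ⟨e.2, r.edgesOf m, ⟨r.isPerfectMatching_edgesOf hm, (r.mem_edgesOf_iff hm he).2 hu⟩, ?_⟩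
    rintro M ⟨hM, heM⟩
    obtain ⟨m', hm', rfl⟩ := r.exists_eq_edgesOf hM
    rw [huniq m' ⟨hm', (r.mem_edgesOf_iff hm' he).1 heM⟩]

/-- The graph formed by the lonely edges. -/
def lonelyGraph (H : SimpleGraph V) : SimpleGraph V where
  Adj := Lonely H
  symm := ⟨fun _ _ h => h.symm⟩
  loopless := ⟨fun _ h => H.irrefl h.1⟩

theorem lonelyGraph_le (H : SimpleGraph V) : lonelyGraph H ≤ H := fun _ _ h => h.1

open scoped Classical in
theorem darts_eq_two_mul (H : SimpleGraph V) : darts H = 2 * #(lonelyGraph H).edgeFinset := by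
  rw [← SimpleGraph.sum_degrees_eq_twice_card_edges]
  unfold darts
  rw [card_filter, ← univ_product_univ, sum_product]
  refine sum_congr rfl fun v _ => ?_
  rw [← card_filter, ← SimpleGraph.card_neighborFinset_eq_degree]
  congr 1
  ext w
  simp only [mem_filter, mem_univ, true_and, SimpleGraph.mem_neighborFinset]
  exact Iff.rfl

theorem Rep.lonelyCount_eq (r : Rep G H) :
    ∃ k : ℕ, G.lonelyCount = k ∧ darts H = 2 * k := by
  classical
  refine ⟨_, ?_, darts_eq_two_mul H⟩
  have h1 : {e | G.IsLonely e} = (fun s : (lonelyGraph H).edgeSet =>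
      (r.ψ.symm ⟨s, SimpleGraph.edgeSet_mono (lonelyGraph_le H) s.2⟩ : β)) '' Set.univ := by
    ext e
    simp only [Set.mem_ofPred_eq, Set.image_univ, Set.mem_range]
    constructor
    · intro he
      obtain ⟨a, b, hab⟩ : ∃ a b, (r.ψ ⟨e, he.1⟩ : Sym2 V) = s(a, b) := by
        induction (r.ψ ⟨e, he.1⟩ : Sym2 V) with | _ a b => exact ⟨a, b, rfl⟩
      refine ⟨⟨s(a, b), (r.isLonely_iff hab).1 he⟩, ?_⟩
      have : r.ψ.symm ⟨s(a, b), hab ▸ (r.ψ ⟨e, he.1⟩).2⟩ = ⟨e, he.1⟩ := by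
        rw [Equiv.symm_apply_eq]
        exact Subtype.ext hab.symm
      rw [this]
    · rintro ⟨⟨s, hs⟩, rfl⟩
      induction s with | _ a b =>
      exact (r.isLonely_iff (by simp)).2 hs
  unfold Graph.lonelyCount
  rw [h1, Function.Injective.encard_image, Set.encard_univ, ENat.card_eq_coe_fintype_card,
    SimpleGraph.edgeFinset_card]
  intro s t h
  have h2 := r.ψ.symm.injective (Subtype.ext h)
  exact Subtype.ext (congrArg (fun z : H.edgeSet => (z : Sym2 V)) h2)

theorem Rep.exists_isLonely_iff (r : Rep G H) :
    (∃ e, G.IsLonely e) ↔ ∃ u v, Lonely H u v := by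
  constructor
  · rintro ⟨e, he⟩
    obtain ⟨a, b, hab⟩ : ∃ a b, (r.ψ ⟨e, he.1⟩ : Sym2 V) = s(a, b) := by
      induction (r.ψ ⟨e, he.1⟩ : Sym2 V) with | _ a b => exact ⟨a, b, rfl⟩
    exact ⟨a, b, (r.isLonely_iff hab).1 he⟩
  · rintro ⟨u, v, h⟩
    obtain ⟨e, he⟩ := r.exists_edge h.1
    exact ⟨e, (r.isLonely_iff he).2 h⟩

theorem Rep.memU_iff (r : Rep G H) : G.MemU ↔
    (∀ v, cut H {v} univ = 3) ∧ VertexConnected3 H ∧ ∃ u v, Lonely H u v := by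
  unfold Graph.MemU
  rw [r.isCubic_iff, r.isVertexConnected_iff, r.exists_isLonely_iff, and_iff_right]
  exact Set.finite_coe_iff.1 (Finite.of_equiv V r.φ.symm)

end Lonely

/-! ### Members of the class have no parallel edges -/

section Simple

variable {α β : Type*} {G : Graph α β}

/-- Deleting fewer than three neighbours, if these were all of them, would isolate `x` from a
further vertex. -/
theorem three_le_encard_adj (hc : G.Loopless) (h : G.IsVertexConnected 3) {x : α} (hx : x ∈ V(G)) :
    3 ≤ {y | G.Adj x y}.encard := by
  by_contra! hlt
  set N := {y | G.Adj x y} with hN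
  obtain ⟨h3, hconn⟩ := h
  obtain ⟨-, hconn⟩ := hconn N (fun y hy => Graph.Adj.right_mem hy) hlt
  have hxN : x ∉ N := fun ⟨e, he⟩ => hc.not_isLoopAt e x he
  have hex : ∃ z ∈ V(G), z ∉ insert x N := by
    by_contra! hno
    have h1 : V(G).encard ≤ N.encard + 1 :=
      (Set.encard_le_encard hno).trans (Set.encard_insert_le _ _)
    have h2 : N.encard + 1 ≤ 3 := Order.add_one_le_of_lt hlt
    exact absurd (h3.trans_le (h1.trans h2)) (lt_irrefl _)
  obtain ⟨z, hz, hzN⟩ := hex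
  rw [Set.mem_insert_iff, not_or] at hzN
  have hwalk := hconn x ⟨hx, hxN⟩ z ⟨hz, hzN.2⟩
  rcases hwalk.cases_head with h1 | ⟨y, ⟨e, he⟩, -⟩
  · exact hzN.1 h1.symm
  · rw [Graph.deleteVerts_isLink] at he
    exact he.2.2 ⟨e, he.1⟩

/-- With two parallel edges at `x`, its three edges would reach at most two neighbours. -/
theorem eq_of_isLink (hc : G.IsCubic) (h : G.IsVertexConnected 3) {x y : α} {e f : β}
    (he : G.IsLink e x y) (hf : G.IsLink f x y) : e = f := by
  by_contra hne
  have h3 := three_le_encard_adj hc.1 h he.left_mem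
  have hother : ∀ g ∈ G.incidenceSet x, ∃ z, G.IsLink g x z := fun g hg => hg
  have : Nonempty α := ⟨x⟩
  choose! o ho using hother
  have h1 : {z | G.Adj x z} ⊆ o '' (G.incidenceSet x \ {f}) := by
    rintro z ⟨g, hg⟩
    by_cases hgf : g = f
    · subst hgf
      have : z = y := hg.right_unique hf
      subst this
      exact ⟨e, ⟨⟨z, he⟩, hne⟩, (ho e ⟨z, he⟩).right_unique he⟩
    · exact ⟨g, ⟨⟨z, hg⟩, hgf⟩, (ho g ⟨z, hg⟩).right_unique hg⟩
  have h2 := (Set.encard_le_encard h1).trans (Set.encard_image_le _ _)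
  have h4 := Set.encard_sdiff_singleton_add_one (s := G.incidenceSet x) (a := f) ⟨y, hf⟩
  rw [hc.2 x he.left_mem] at h4
  have h5 : (3 : ℕ∞) + 1 ≤ 3 := (add_le_add_left (h3.trans h2) 1).trans h4.le
  exact absurd h5 (by decide)

theorem exists_rep (hc : G.IsCubic) (h : G.IsVertexConnected 3) :
    Nonempty (Rep G G.toSimpleGraph) := by
  have := hc.1
  have hends : ∀ e : E(G), ∃ x y : V(G), G.IsLink e x y := by
    rintro ⟨e, he⟩
    obtain ⟨x, y, hxy⟩ := Graph.exists_isLink_of_mem_edgeSet he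
    exact ⟨⟨x, hxy.left_mem⟩, ⟨y, hxy.right_mem⟩, hxy⟩
  choose a b hab using hends
  let f : E(G) → G.toSimpleGraph.edgeSet := fun e => ⟨s(a e, b e), by
    rw [SimpleGraph.mem_edgeSet, Graph.toSimpleGraph_adj_iff]
    exact ⟨e, hab e⟩⟩
  have hlink : ∀ (e : E(G)) (x y : V(G)), G.IsLink e x y ↔ s(a e, b e) = s(x, y) := by
    intro e x y
    rw [(hab e).isLink_iff, Sym2.eq_iff, Subtype.ext_iff, Subtype.ext_iff, Subtype.ext_iff,
      Subtype.ext_iff]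
  have hf : Function.Bijective f := by
    constructor
    · intro e e' hee
      have h1 : s(a e, b e) = s(a e', b e') := congrArg Subtype.val hee
      exact Subtype.ext (eq_of_isLink hc h ((hlink e _ _).2 h1) (hab e'))
    · rintro ⟨s, hs⟩
      induction s with | _ x y =>
      rw [SimpleGraph.mem_edgeSet, Graph.toSimpleGraph_adj_iff] at hs
      obtain ⟨e, he⟩ := hs
      exact ⟨⟨e, he.edge_mem⟩, Subtype.ext ((hlink ⟨e, he.edge_mem⟩ x y).1 he)⟩
  exact ⟨⟨Equiv.refl _, Equiv.ofBijective f hf, hlink⟩⟩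

end Simple

/-! ### Assembling the result -/

theorem exists_cubic3_of_memU {α β : Type*} {G : Graph α β} (h : G.MemU) :
    ∃ (_ : Fintype V(G)) (H : SimpleGraph V(G)), Nonempty (Rep G H) ∧ Cubic3 H ∧
      ∃ u v, Lonely H u v := by
  have := h.1.fintype
  obtain ⟨r⟩ := LonelyEdge.exists_rep h.2.1 h.2.2.1
  obtain ⟨h1, h2, h3⟩ := r.memU_iff.1 h
  exact ⟨this, _, ⟨r⟩, h2.cubic3 h1, h3⟩

theorem cut_singleton_univ {V : Type*} [Fintype V] {H : SimpleGraph V} [DecidableRel H.Adj] (v : V) :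
    cut H {v} univ = #(univ.filter fun w => H.Adj v w) := by
  rw [cut_singleton]
  congr

/-- For fixed `P` the largest admissible `Q` consists of all vertices outside `P` with no neighbour
in `P`, so a finite check over `P` alone suffices. -/
theorem vertexConnected3_of_forall {V : Type*} [Fintype V] [DecidableEq V] {H : SimpleGraph V}
    [DecidableRel H.Adj] (hV : 3 < Fintype.card V)
    (h : ∀ P : Finset V, P.Nonempty → (univ.filter fun y => y ∉ P ∧ ∀ x ∈ P, ¬ H.Adj x y).Nonempty →
      #P + #(univ.filter fun y => y ∉ P ∧ ∀ x ∈ P, ¬ H.Adj x y) + 3 ≤ Fintype.card V) :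
    VertexConnected3 H := by
  refine ⟨hV, fun P Q hP hQ hd hadj => ?_⟩
  have hsub : Q ⊆ univ.filter fun y => y ∉ P ∧ ∀ x ∈ P, ¬ H.Adj x y := by
    intro y hy
    simp only [mem_filter, mem_univ, true_and]
    exact ⟨fun h => Finset.disjoint_left.1 hd h hy, fun x hx => hadj x hx y hy⟩
  have h1 := card_le_card hsub
  have h2 := h P hP (hQ.mono hsub)
  omega

theorem vertexConnected3_completeFour : VertexConnected3 (⊤ : SimpleGraph (Fin 4)) :=
  vertexConnected3_of_forall (by decide) (by decide +kernel)

theorem vertexConnected3_prism : VertexConnected3 prismGraph :=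
  vertexConnected3_of_forall (by decide) (by decide +kernel)

theorem vertexConnected3_bicorn : VertexConnected3 bicornGraph :=
  vertexConnected3_of_forall (by decide) (by decide +kernel)

theorem exists_lonely_of_darts {V : Type*} [Fintype V] {H : SimpleGraph V} (h : 0 < darts H) :
    ∃ u v, Lonely H u v := by
  classical
  obtain ⟨q, hq⟩ := card_pos.1 h
  exact ⟨q.1, q.2, by simpa using hq⟩

theorem Rep.memUExactly {α β V : Type*} [Fintype V] {G : Graph α β} {H : SimpleGraph V}
    (r : Rep G H) {k : ℕ} (hdeg : ∀ v, cut H {v} univ = 3) (hH : VertexConnected3 H)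
    (hk : 0 < k) (hd : darts H = 2 * k) : G.MemUExactly k := by
  refine ⟨r.memU_iff.2 ⟨hdeg, hH, exists_lonely_of_darts (by omega)⟩, ?_⟩
  obtain ⟨k', h1, h2⟩ := r.lonelyCount_eq
  rw [h1, show k' = k by omega]

end LonelyEdge

theorem mainTheorem3 {α β : Type*} (G : Graph α β) :
    (G.MemU → G.lonelyCount ≤ 6) ∧
    (G.MemUExactly 6 ↔ G.IsIsomorphic Graph.completeFour ∨ G.IsIsomorphic Graph.prism) ∧
    (G.MemUExactly 5 ↔ G.IsIsomorphic Graph.bicorn) := by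
  have hK : G.IsIsomorphic Graph.completeFour ↔
      Nonempty (LonelyEdge.Rep G (⊤ : SimpleGraph (Fin 4))) :=
    LonelyEdge.isIsomorphic_ofSimpleGraph_iff
  have hP : G.IsIsomorphic Graph.prism ↔ Nonempty (LonelyEdge.Rep G LonelyEdge.prismGraph) :=
    LonelyEdge.isIsomorphic_ofSimpleGraph_iff
  have hB : G.IsIsomorphic Graph.bicorn ↔ Nonempty (LonelyEdge.Rep G LonelyEdge.bicornGraph) :=
    LonelyEdge.isIsomorphic_ofSimpleGraph_iff
  -- Each edge gives two darts, so the bound of 8 darts outside the three exceptional graphs means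
  -- at most 4 lonely edges; all three claims follow from this.
  have key : G.MemU → ∃ k : ℕ, G.lonelyCount = k ∧
      ((k = 6 ∧ G.IsIsomorphic Graph.completeFour) ∨ (k = 6 ∧ G.IsIsomorphic Graph.prism) ∨
        (k = 5 ∧ G.IsIsomorphic Graph.bicorn) ∨ k ≤ 4) := by
    intro h
    obtain ⟨_, H, ⟨r⟩, hH, hl⟩ := LonelyEdge.exists_cubic3_of_memU h
    obtain ⟨k, hk, hd⟩ := r.lonelyCount_eq
    refine ⟨k, hk, ?_⟩
    rcases hH.classification _ _ _ rfl hl with ⟨⟨e⟩⟩ | ⟨⟨e⟩⟩ | ⟨⟨e⟩⟩ | h8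
    · rw [LonelyEdge.darts_eq_of_iso e, LonelyEdge.darts_completeFour] at hd
      exact Or.inl ⟨by omega, hK.2 ⟨r.trans e⟩⟩
    · rw [LonelyEdge.darts_eq_of_iso e, LonelyEdge.darts_prism] at hd
      exact Or.inr (Or.inl ⟨by omega, hP.2 ⟨r.trans e⟩⟩)
    · rw [LonelyEdge.darts_eq_of_iso e, LonelyEdge.darts_bicorn] at hd
      exact Or.inr (Or.inr (Or.inl ⟨by omega, hB.2 ⟨r.trans e⟩⟩))
    · exact Or.inr (Or.inr (Or.inr (by omega)))
  refine ⟨fun h => ?_, ⟨fun ⟨h, h6⟩ => ?_, ?_⟩, ⟨fun ⟨h, h5⟩ => ?_, ?_⟩⟩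
  · obtain ⟨k, hk, h1⟩ := key h
    rw [hk]
    have : k ≤ 6 := by omega
    exact_mod_cast this
  · obtain ⟨k, hk, h1⟩ := key h
    have hk6 : k = 6 := by
      rw [hk] at h6
      exact_mod_cast h6
    rcases h1 with h1 | h1 | h1 | h1
    · exact Or.inl h1.2
    · exact Or.inr h1.2
    · omega
    · omega
  · rintro (h | h)
    · obtain ⟨r⟩ := hK.1 h
      refine r.memUExactly ?_ LonelyEdge.vertexConnected3_completeFour (by omega)
        LonelyEdge.darts_completeFour
      intro v
      rw [LonelyEdge.cut_singleton_univ]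
      revert v
      decide
    · obtain ⟨r⟩ := hP.1 h
      refine r.memUExactly ?_ LonelyEdge.vertexConnected3_prism (by omega) LonelyEdge.darts_prism
      intro v
      rw [LonelyEdge.cut_singleton_univ]
      revert v
      decide
  · obtain ⟨k, hk, h1⟩ := key h
    have hk5 : k = 5 := by
      rw [hk] at h5
      exact_mod_cast h5
    rcases h1 with h1 | h1 | h1 | h1
    · omega
    · omega
    · exact h1.2
    · omega
  · intro h
    obtain ⟨r⟩ := hB.1 h
    refine r.memUExactly ?_ LonelyEdge.vertexConnected3_bicorn (by omega) LonelyEdge.darts_bicorn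
    intro v
    rw [LonelyEdge.cut_singleton_univ]
    revert v
    decide
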